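/- Let $\mathbb{F}_q$ be a finite field with $q$ elements, $A=\mathbb{F}_q[\theta]$, $K=\mathbb{F}_q(\theta)$, and let $A_+$ be the set of monic elements of $A$. For $a\in A$ and an $A$-algebra $R$ let $C_a:R\to R$ be the Carlitz action, that is, $a\mapsto C_a$ is the morphism of $\mathbb{F}_q$-algebras from $A$ to the $\mathbb{F}_q$-linear endomorphisms of $R$ with $C_\theta(x)=\theta x+x^q$. Let $s\ge 1$ be an integer and let $X_1,\dots,X_s,Z$ be indeterminates. For $a\in A\setminus\{0\}$ and $G\in K[X_1,\dots,X_s][[Z]]$ put \[a*G=G\bigl(C_a(X_1),\dots,C_a(X_s),Z^{q^{\deg_\theta a}}\bigr).\] Put $D_0=1$, $D_i=(\theta^{q^i}-\theta)D_{i-1}^q$ for $i\ge 1$, and $\exp_C(G)=\sum_{i\ge 0}\frac{G^{q^i}}{D_i}$ for $G\in Z\,K[X_1,\dots,X_s][[Z]]$. Define \[\mathbb{S}_s=\exp_C\Bigl(\sum_{a\in A_+}\frac{a*(X_1\cdots X_sZ)}{a}\Bigr)\in K[X_1,\dots,X_s][[Z]].\] Then $\mathbb{S}_s$ is a polynomial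 in $A[X_1,\dots,X_s,Z]$, and: 1. $\mathbb{S}_s$ is $\mathbb{F}_q$-linear with respect to each of the variables $X_1,\dots,X_s,Z$ (additive in that variable, and substituting $cV$ for the variable $V$ multiplies the polynomial by $c$, for every $c\in\mathbb{F}_q$); in particular it is divisible by $X_1\cdots X_sZ$. 2. If $r\in\{1,\dots,q-1\}$ satisfies $s\equiv r \pmod{q-1}$, then $\deg_Z\mathbb{S}_s\le q^{(s-r)/(q-1)}$. In particular, if $1\le s\le q-1$, then $\mathbb{S}_s=X_1\cdots X_sZ$. -/

import Mathlib

open scoped Polynomial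

noncomputable section

namespace AndersonStark

/-! Throughout, `Fq` is a finite field with `q = Fintype.card Fq` elements,
`A = Fq[X]` (whose variable is written `θ`), `K = RatFunc Fq` is the field of fractions of `A`,
and `K[X][[Z]]` is `PowerSeries (MvPolynomial σ (RatFunc Fq))`, with `σ = Fin s`. -/

variable (Fq : Type*) [Field Fq] [Fintype Fq]

/-- The Carlitz module `C : A → A[τ]`, `C_θ = θ + τ`, seen through the action it induces on
an `A`-algebra `R` on which `τ` acts by `x ↦ x ^ q`: the unique morphism of `Fq`-algebras
`A → End_{Fq}(R)` that sends `θ` to `x ↦ θ x + x ^ q`. -/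
def carlitz (R : Type*) [CommRing R] [Algebra Fq R] [Algebra Fq[X] R] :
    Fq[X] →ₐ[Fq] Module.End Fq R :=
  Polynomial.aeval
    (LinearMap.mulLeft Fq (algebraMap Fq[X] R Polynomial.X) +
      (FiniteField.frobeniusAlgHom Fq R).toLinearMap)

/-- The Carlitz factorials `D_0 = 1`, `D_i = (θ ^ (q ^ i) - θ) * D_{i-1} ^ q`. -/
def carlitzD : ℕ → Fq[X]
  | 0 => 1
  | i + 1 => (Polynomial.X ^ Fintype.card Fq ^ (i + 1) - Polynomial.X) *
      carlitzD i ^ Fintype.card Fq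

variable {Fq} {σ : Type*}

/-- The action of `a ∈ A` on `K[X]`: `a * F = F(C_a(X_1), …, C_a(X_s))`. -/
def starPoly (a : Fq[X]) (F : MvPolynomial σ (RatFunc Fq)) : MvPolynomial σ (RatFunc Fq) :=
  MvPolynomial.aeval
    (fun j => carlitz Fq (MvPolynomial σ (RatFunc Fq)) a (MvPolynomial.X j)) F

/-- The action of `a ∈ A`, `a ≠ 0`, on `K[X][[Z]]`:
`a * G = G(C_a(X_1), …, C_a(X_s), Z ^ (q ^ deg a))`. -/
def starSeries (a : Fq[X]) (G : PowerSeries (MvPolynomial σ (RatFunc Fq))) :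
    PowerSeries (MvPolynomial σ (RatFunc Fq)) :=
  PowerSeries.expand (Fintype.card Fq ^ a.natDegree) (pow_ne_zero _ Fintype.card_ne_zero)
    (PowerSeries.mk fun n => starPoly a (PowerSeries.coeff n G))

/-- `l(F, Z) = ∑_{a ∈ A monic} (a * (F Z)) / a`. The sum is taken coefficient by coefficient: only
the finitely many monic `a` with `q ^ deg a = n` contribute to the coefficient of `Z ^ n`. -/
def lSeries (F : MvPolynomial σ (RatFunc Fq)) : PowerSeries (MvPolynomial σ (RatFunc Fq)) :=
  PowerSeries.mk fun n => ∑ᶠ (a : Fq[X]) (_ : a.Monic),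
    (algebraMap Fq[X] (RatFunc Fq) a)⁻¹ •
      PowerSeries.coeff n (starSeries a (PowerSeries.C F * PowerSeries.X))

/-- The Carlitz exponential `exp_C = ∑_i D_i⁻¹ τ ^ i` on series `G ∈ Z K[X][[Z]]`, where `τ` is the
`q`-th power map. The sum is taken coefficient by coefficient: as `Z ∣ G`, only the `i` with
`q ^ i ≤ n` contribute to the coefficient of `Z ^ n`. -/
def carlitzExp (G : PowerSeries (MvPolynomial σ (RatFunc Fq))) :
    PowerSeries (MvPolynomial σ (RatFunc Fq)) :=
  PowerSeries.mk fun n => ∑ᶠ i : ℕ,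
    (algebraMap Fq[X] (RatFunc Fq) (carlitzD Fq i))⁻¹ •
      PowerSeries.coeff n (G ^ Fintype.card Fq ^ i)

/-- `𝔏(F, Z) = exp_C (l(F, Z)) ∈ K[X][[Z]]`. -/
def logAlgSeries (F : MvPolynomial σ (RatFunc Fq)) :
    PowerSeries (MvPolynomial σ (RatFunc Fq)) :=
  carlitzExp (lSeries F)

variable (Fq) in
/-- The series `𝕊_s = 𝔏(X_1 ⋯ X_s, Z)`. -/
def specialSeries (s : ℕ) : PowerSeries (MvPolynomial (Fin s) (RatFunc Fq)) :=
  logAlgSeries (∏ j : Fin s, MvPolynomial.X j)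

variable (Fq σ) in
/-- The inclusion `A[X, Z] → K[X][[Z]]`. The variable `X_j` of `A[X, Z]` is indexed by `some j` and
the variable `Z` by `none`. -/
def toSeries : MvPolynomial (Option σ) Fq[X] →+*
    PowerSeries (MvPolynomial σ (RatFunc Fq)) :=
  (Polynomial.coeToPowerSeries.ringHom.comp
    (Polynomial.mapRingHom (MvPolynomial.map (algebraMap Fq[X] (RatFunc Fq))))).comp
    (MvPolynomial.optionEquivLeft Fq[X] σ : _ →+* _)

theorem toSeries_injective (k τ : Type*) [Field k] : Function.Injective (toSeries k τ) := by
  intro P Q h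
  simp only [toSeries, RingHom.comp_apply, Polynomial.coeToPowerSeries.ringHom_apply,
    Polynomial.coe_inj, Polynomial.coe_mapRingHom, RingHom.coe_coe] at h
  exact (MvPolynomial.optionEquivLeft k[X] τ).injective
    (Polynomial.map_injective _
      (MvPolynomial.map_injective _ (IsFractionRing.injective k[X] (RatFunc k))) h)

variable (Fq) in
/-- `P` is `Fq`-linear with respect to the variable `j`: as polynomials (with one more variable
`Y`, indexed by `none`), `P(…, X_j + Y, …) = P(…, X_j, …) + P(…, Y, …)`, and
`P(…, c X_j, …) = c P(…, X_j, …)` for all `c ∈ Fq`. -/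
def IsFqLinearIn {ι R : Type*} [DecidableEq ι] [CommRing R] [Algebra Fq R]
    (P : MvPolynomial ι R) (j : ι) : Prop :=
  MvPolynomial.aeval (Function.update
      (fun i => (MvPolynomial.X (some i) : MvPolynomial (Option ι) R)) j
      (MvPolynomial.X (some j) + MvPolynomial.X none)) P =
    MvPolynomial.aeval (fun i => (MvPolynomial.X (some i) : MvPolynomial (Option ι) R)) P +
    MvPolynomial.aeval (Function.update
      (fun i => (MvPolynomial.X (some i) : MvPolynomial (Option ι) R)) j
      (MvPolynomial.X none)) P ∧
  ∀ c : Fq, MvPolynomial.aeval (Function.update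
      (fun i => (MvPolynomial.X i : MvPolynomial ι R)) j (c • MvPolynomial.X j)) P = c • P

end AndersonStark

end

/-! The coefficient of Z^(q^d) in 𝕊_s is a K-combination of products C_{θ^m_1}(X_1)⋯C_{θ^m_s}(X_s).
Encode such a product as the monomial t_1^m_1⋯t_s^m_s. Then C_a(X_1)⋯C_a(X_s) becomes a(t_1)⋯a(t_s),
and the q-th power becomes the semilinear operator `tau`: Frobenius on coefficients, then
multiplication by ∏(t_k - θ). The coefficient becomes `starkCoeff`, the sum over i of D_i⁻¹ τ^i
applied to ∑ a(t_1)⋯a(t_s)/a over monic a of degree d - i. It remains to show that it has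
coefficients in A, and vanishes when d ≥ 1 and s ≤ d(q-1).

Integrality is proved at every monic irreducible P, by strong induction on d (`gaussLE_starkCoeff`).
As exp_C intertwines a with C_a (`expSeq_smul`), applying C_P to the exponential multiplies its
argument by P. The new argument splits into P times the sum over a prime to P, and P(t_1)⋯P(t_s)
times the old sum shifted by deg P (`sum_carlitzCoeff_smul_starkCoeff`). The first part contributes
multiples of P, since ord_P D_i ≤ q^i - 1. Modulo P, C_P is τ^(deg P), which acts on P-integral data
coming from A[t] as multiplication by P(t_1)⋯P(t_s) (`gaussLE_tau_sub`), cancelling the second part.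
So P divides P · `starkCoeff` d.

At infinity, the i-th term has θ-degree at most s(q^i-1)/(q-1) - d q^i, which is at most -d when s ≤
d(q-1). An element of A of negative degree is zero (`starkCoeff_eq_zero`). Linearity and
divisibility by the variables hold for each product of Carlitz polynomials. -/

set_option linter.unusedSectionVars false

noncomputable section

namespace AndersonStark

/-! ### Coefficients of the Carlitz module in A{τ} -/

section CarlitzCoefficients

variable (Fq : Type*) [Field Fq] [Fintype Fq]

local notation "q" => Fintype.card Fq

/-- Left multiplication by `C_θ = θ + τ` on sequences of coefficients of elements of `A{τ}`. -/
def carlitzLeft : Module.End Fq (ℕ → Fq[X]) where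
  toFun f i := Polynomial.X * f i + Nat.casesOn i 0 fun k => f k ^ q
  map_add' f g := by
    funext i
    cases i with
    | zero => simp [mul_add]
    | succ k =>
      have := map_add (FiniteField.frobeniusAlgHom Fq Fq[X]) (f k) (g k)
      simp only [FiniteField.coe_frobeniusAlgHom] at this
      simp only [Pi.add_apply, this]
      ring
  map_smul' c f := by
    funext i
    cases i with
    | zero => simp
    | succ k =>
      have := map_smul (FiniteField.frobeniusAlgHom Fq Fq[X]) c (f k)
      simp only [FiniteField.coe_frobeniusAlgHom] at this
      simp only [Pi.smul_apply, this, RingHom.id_apply, smul_add, mul_smul_comm]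

/-- Right multiplication by `C_θ = θ + τ` on sequences of coefficients of elements of `A{τ}`. -/
def carlitzRight : Module.End Fq (ℕ → Fq[X]) where
  toFun f i := Polynomial.X ^ q ^ i * f i + Nat.casesOn i 0 fun k => f k
  map_add' f g := by
    funext i
    cases i with
    | zero => simp [mul_add]
    | succ k =>
      simp only [Pi.add_apply]
      ring
  map_smul' c f := by
    funext i
    cases i with
    | zero => simp
    | succ k => simp only [Pi.smul_apply, RingHom.id_apply, smul_add, mul_smul_comm]

variable {Fq}

@[simp] theorem carlitzLeft_zero (f : ℕ → Fq[X]) : carlitzLeft Fq f 0 = Polynomial.X * f 0 := by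
  simp [carlitzLeft]

@[simp] theorem carlitzLeft_succ (f : ℕ → Fq[X]) (i : ℕ) :
    carlitzLeft Fq f (i + 1) = Polynomial.X * f (i + 1) + f i ^ q := rfl

@[simp] theorem carlitzRight_zero (f : ℕ → Fq[X]) : carlitzRight Fq f 0 = Polynomial.X * f 0 := by
  simp [carlitzRight]

@[simp] theorem carlitzRight_succ (f : ℕ → Fq[X]) (i : ℕ) :
    carlitzRight Fq f (i + 1) = Polynomial.X ^ q ^ (i + 1) * f (i + 1) + f i := rfl

theorem add_pow_card {R : Type*} [CommRing R] [Algebra Fq R] (x y : R) :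
    (x + y) ^ q = x ^ q + y ^ q := map_add (FiniteField.frobeniusAlgHom Fq R) x y

variable (Fq) in
/-- The `Fq`-algebra endomorphism `x ↦ x ^ (q ^ n)`. -/
def frobeniusPow (R : Type*) [CommRing R] [Algebra Fq R] (n : ℕ) : R →ₐ[Fq] R :=
  FiniteField.frobeniusAlgHom Fq R ^ n

theorem frobeniusPow_apply {R : Type*} [CommRing R] [Algebra Fq R] (n : ℕ) (x : R) :
    frobeniusPow Fq R n x = x ^ q ^ n := by
  induction n with
  | zero => simp [frobeniusPow]
  | succ n ih =>
    rw [frobeniusPow] at ih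
    rw [frobeniusPow, pow_succ', AlgHom.mul_apply, ih, FiniteField.coe_frobeniusAlgHom]
    exact (pow_mul x _ _).symm

/-- Associativity of A{τ}, where τθ = θ^q τ. -/
theorem carlitzLeft_comm_carlitzRight : Commute (carlitzLeft Fq) (carlitzRight Fq) := by
  refine LinearMap.ext fun f => funext fun i => ?_
  simp only [Module.End.mul_apply]
  rcases i with _ | _ | i
  · simp
  · simp only [carlitzLeft_succ, carlitzRight_succ, carlitzLeft_zero, carlitzRight_zero, mul_pow]
    ring
  · simp only [carlitzLeft_succ, carlitzRight_succ, add_pow_card, mul_pow, ← pow_mul, ← pow_succ]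
    ring

/-- The coefficients of `C_a = ∑ carlitzCoeff a i τ ^ i`. -/
def carlitzCoeff (a : Fq[X]) : ℕ → Fq[X] :=
  Polynomial.aeval (carlitzLeft Fq) a (Pi.single 0 1)

theorem carlitzCoeff_add (a b : Fq[X]) : carlitzCoeff (a + b) = carlitzCoeff a + carlitzCoeff b := by
  simp [carlitzCoeff]

theorem carlitzCoeff_C (c : Fq) : carlitzCoeff (Polynomial.C c) = c • Pi.single 0 1 := by
  simp [carlitzCoeff]

theorem carlitzCoeff_X_mul (a : Fq[X]) :
    carlitzCoeff (Polynomial.X * a) = carlitzLeft Fq (carlitzCoeff a) := by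
  simp [carlitzCoeff]

/-- C_a commutes with C_θ: it is a polynomial in C_θ with coefficients in Fq. Comparing the two
multiplications yields the recursion `carlitzCoeff_rec`. -/
theorem carlitzCoeff_X_mul' (a : Fq[X]) :
    carlitzCoeff (Polynomial.X * a) = carlitzRight Fq (carlitzCoeff a) := by
  have h : carlitzLeft Fq (Pi.single 0 1) = carlitzRight Fq (Pi.single 0 1) := by
    funext i
    rcases i with _ | _ | i <;> simp
  have hc : Commute (Polynomial.aeval (carlitzLeft Fq) a) (carlitzRight Fq) := by
    induction a using Polynomial.induction_on with
    | C c =>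
      rw [Polynomial.aeval_C]
      exact Algebra.commutes c (carlitzRight Fq)
    | add a b ha hb => simpa using ha.add_left hb
    | monomial n c _ =>
      simp only [map_mul, Polynomial.aeval_C, map_pow, Polynomial.aeval_X]
      exact Commute.mul_left (Algebra.commutes c (carlitzRight Fq))
        (carlitzLeft_comm_carlitzRight.pow_left _)
  have h2 := LinearMap.congr_fun hc.eq (Pi.single 0 1)
  simp only [Module.End.mul_apply] at h2
  rw [carlitzCoeff, mul_comm, map_mul, Polynomial.aeval_X, Module.End.mul_apply, h, h2]
  rfl

theorem carlitzCoeff_zero (a : Fq[X]) : carlitzCoeff a 0 = a := by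
  induction a using Polynomial.induction_on' with
  | add a b ha hb => simp [carlitzCoeff_add, ha, hb]
  | monomial n c =>
    induction n with
    | zero => simp [carlitzCoeff_C, Polynomial.smul_eq_C_mul]
    | succ n ih =>
      have : Polynomial.monomial (n + 1) c = Polynomial.X * Polynomial.monomial n c := by
        rw [Polynomial.X_mul_monomial]
      rw [this, carlitzCoeff_X_mul, carlitzLeft_zero, ih]

theorem carlitzCoeff_of_natDegree_le {a : Fq[X]} {n : ℕ} (h : a.natDegree ≤ n) :
    carlitzCoeff a n = Polynomial.C (a.coeff n) := by
  -- The degree bound m is separated from the index, since the induction needs a/θ at two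
  -- consecutive indices.
  suffices ∀ m (a : Fq[X]), a.natDegree ≤ m → ∀ n, m ≤ n →
    carlitzCoeff a n = Polynomial.C (a.coeff n) from this _ a h n le_rfl
  clear h a n
  intro m
  induction m with
  | zero =>
    intro a ha n _
    obtain ⟨c, rfl⟩ := Polynomial.natDegree_eq_zero.mp (Nat.le_zero.mp ha)
    rcases n with _ | n <;> simp [carlitzCoeff_C, Polynomial.coeff_C, Polynomial.smul_eq_C_mul]
  | succ m ih =>
    intro a ha n hn
    obtain ⟨n, rfl⟩ : ∃ k, n = k + 1 := ⟨n - 1, by omega⟩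
    have hd : a.divX.natDegree ≤ m := by
      rw [Polynomial.natDegree_divX_eq_natDegree_tsub_one]
      omega
    have h0 : carlitzCoeff a.divX (n + 1) = 0 := by
      rw [ih _ hd _ (by omega), Polynomial.coeff_eq_zero_of_natDegree_lt (by omega), map_zero]
    conv_lhs => rw [← Polynomial.divX_mul_X_add a, mul_comm, carlitzCoeff_add, carlitzCoeff_X_mul]
    rw [Pi.add_apply, carlitzLeft_succ, h0, ih _ hd _ (by omega), carlitzCoeff_C, ← map_pow,
      FiniteField.pow_card, Polynomial.coeff_divX]
    simp

theorem carlitzCoeff_rec (a : Fq[X]) (i : ℕ) :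
    carlitzCoeff a (i + 1) * (Polynomial.X ^ q ^ (i + 1) - Polynomial.X) =
      carlitzCoeff a i ^ q - carlitzCoeff a i := by
  have h := congrFun ((carlitzCoeff_X_mul a).symm.trans (carlitzCoeff_X_mul' a)) (i + 1)
  simp only [carlitzLeft_succ, carlitzRight_succ] at h
  linear_combination -h

/-- The recursion propagates divisibility by P, because P does not divide θ^(q^j) - θ for 0 < j <
deg P. -/
theorem dvd_carlitzCoeff {P : Fq[X]} (hP : Irreducible P) {i : ℕ} (hi : i < P.natDegree) :
    P ∣ carlitzCoeff P i := by
  induction i with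
  | zero => rw [carlitzCoeff_zero]
  | succ i ih =>
    have h := carlitzCoeff_rec P i
    have ih := ih (by omega)
    have : P ∣ carlitzCoeff P (i + 1) * (Polynomial.X ^ q ^ (i + 1) - Polynomial.X) := by
      rw [h]
      exact dvd_sub (ih.trans (dvd_pow_self _ Fintype.card_ne_zero)) ih
    refine (hP.prime.dvd_or_dvd this).resolve_right fun h2 => ?_
    rw [← Nat.card_eq_fintype_card] at h2
    have := Nat.le_of_dvd (by omega) (hP.natDegree_dvd_of_dvd_X_pow_card_pow_sub_X h2)
    omega

/-- With n = deg P, a^(q^n) is a evaluated at θ^(q^n), and P divides θ^(q^n) - θ. -/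
theorem dvd_pow_card_pow_natDegree_sub {P : Fq[X]} (hP : Irreducible P) (a : Fq[X]) :
    P ∣ a ^ q ^ P.natDegree - a := by
  have h := hP.natDegree_dvd_iff_dvd_X_pow_card_pow_sub_X.mp (dvd_refl P.natDegree)
  rw [Nat.card_eq_fintype_card] at h
  have h2 := Polynomial.sub_dvd_eval_sub (Polynomial.X ^ q ^ P.natDegree) Polynomial.X
    (a.map Polynomial.C)
  have h3 := Polynomial.aeval_algHom_apply (frobeniusPow Fq Fq[X] P.natDegree) Polynomial.X a
  rw [Polynomial.aeval_X_left_apply, frobeniusPow_apply, frobeniusPow_apply] at h3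
  rw [Polynomial.eval_map, Polynomial.eval_map, Polynomial.eval₂_C_X] at h2
  rw [← h3]
  exact h.trans h2

variable (Fq) in
/-- The polynomials `b_i(x) = ∏_{j < i} (x - θ ^ (q ^ j))`. -/
def carlitzBasis {R : Type*} [CommRing R] [Algebra Fq[X] R] (x : R) (i : ℕ) : R :=
  ∏ j ∈ Finset.range i, (x - algebraMap Fq[X] R (Polynomial.X ^ q ^ j))

/-- Multiplication by x on the b_i follows the rule of right multiplication by C_θ on the τ^i: x b_i
= b_{i+1} + θ^(q^i) b_i. Taken modulo P, this formula identifies b_{deg P} with P(x). -/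
theorem aeval_eq_sum_carlitzCoeff {R : Type*} [CommRing R] [Algebra Fq R] [Algebra Fq[X] R]
    [IsScalarTower Fq Fq[X] R] (x : R) {a : Fq[X]} {n : ℕ} (h : a.natDegree ≤ n) :
    Polynomial.aeval x a = ∑ i ∈ Finset.range (n + 1), carlitzCoeff a i • carlitzBasis Fq x i := by
  induction n generalizing a with
  | zero =>
    obtain ⟨c, rfl⟩ := Polynomial.natDegree_eq_zero.mp (Nat.le_zero.mp h)
    simp [carlitzBasis, carlitzCoeff_C, Algebra.algebraMap_eq_smul_one]
  | succ n ih =>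
    have hd : a.divX.natDegree ≤ n := by
      rw [Polynomial.natDegree_divX_eq_natDegree_tsub_one]
      omega
    have h0 : carlitzCoeff a.divX (n + 1) = 0 := by
      rw [carlitzCoeff_of_natDegree_le (by omega),
        Polynomial.coeff_eq_zero_of_natDegree_lt (by omega), map_zero]
    have hb (i : ℕ) : x * carlitzBasis Fq x i = carlitzBasis Fq x (i + 1) +
        (Polynomial.X ^ q ^ i : Fq[X]) • carlitzBasis Fq x i := by
      rw [carlitzBasis, carlitzBasis, Finset.prod_range_succ, Algebra.smul_def]
      ring
    have hb0 : carlitzBasis Fq x 0 = 1 := by simp [carlitzBasis]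
    -- Shifting the index by one costs nothing at the top, because `h0` kills the extra coefficient.
    have h1 : ∑ i ∈ Finset.range (n + 1), algebraMap Fq[X] R (Polynomial.X ^ q ^ (i + 1)) *
          algebraMap Fq[X] R (carlitzCoeff a.divX (i + 1)) * carlitzBasis Fq x (i + 1) +
          algebraMap Fq[X] R (Polynomial.X * carlitzCoeff a.divX 0) =
        ∑ i ∈ Finset.range (n + 1), algebraMap Fq[X] R (Polynomial.X ^ q ^ i) *
          algebraMap Fq[X] R (carlitzCoeff a.divX i) * carlitzBasis Fq x i := by
      have h2 := Finset.sum_range_succ' (fun i => algebraMap Fq[X] R (Polynomial.X ^ q ^ i) *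
          algebraMap Fq[X] R (carlitzCoeff a.divX i) * carlitzBasis Fq x i) (n + 1)
      rw [Finset.sum_range_succ, h0, map_zero, mul_zero, zero_mul, add_zero] at h2
      rw [h2, hb0, mul_one, pow_zero, pow_one, map_mul]
    conv_lhs => rw [← Polynomial.divX_mul_X_add a, mul_comm, map_add, map_mul, Polynomial.aeval_X,
      ih hd, Polynomial.aeval_C, Finset.mul_sum]
    conv_rhs => rw [← Polynomial.divX_mul_X_add a, mul_comm, carlitzCoeff_add, carlitzCoeff_X_mul',
      carlitzCoeff_C, Finset.sum_range_succ', Pi.add_apply, carlitzRight_zero, hb0]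
    have h3 (i : ℕ) : (carlitzRight Fq (carlitzCoeff a.divX) +
        a.coeff 0 • (Pi.single 0 1 : ℕ → Fq[X])) (i + 1) =
        Polynomial.X ^ q ^ (i + 1) * carlitzCoeff a.divX (i + 1) + carlitzCoeff a.divX i := by simp
    have h4 : algebraMap Fq R (a.coeff 0) = algebraMap Fq[X] R (a.coeff 0 • 1) := by
      rw [← Algebra.algebraMap_eq_smul_one, ← IsScalarTower.algebraMap_apply]
    simp only [h3, mul_smul_comm, hb]
    simp only [Algebra.smul_def, map_add, map_mul, add_mul,
      Finset.sum_add_distrib, Pi.smul_apply, Pi.single_eq_same, h4, mul_one] at h1 ⊢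
    have h5 : ∀ i, algebraMap Fq[X] R (carlitzCoeff a.divX i) *
        (algebraMap Fq[X] R (Polynomial.X ^ q ^ i) * carlitzBasis Fq x i) =
        algebraMap Fq[X] R (Polynomial.X ^ q ^ i) *
        algebraMap Fq[X] R (carlitzCoeff a.divX i) * carlitzBasis Fq x i := fun i => by ring
    simp only [mul_add, h5, Finset.sum_add_distrib]
    linear_combination -h1

end CarlitzCoefficients
end AndersonStark

end

noncomputable section

namespace AndersonStark

/-! ### Functional equation of the Carlitz exponential -/

section Exponential

variable {Fq : Type*} [Field Fq] [Fintype Fq]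

local notation "q" => Fintype.card Fq

theorem carlitzD_ne_zero (i : ℕ) : carlitzD Fq i ≠ 0 := by
  induction i with
  | zero => simp [carlitzD]
  | succ i ih =>
    exact mul_ne_zero (FiniteField.X_pow_card_pow_sub_X_ne_zero _ i.succ_ne_zero
      Fintype.one_lt_card) (pow_ne_zero _ ih)

variable {M : Type*} [AddCommGroup M] [Module (RatFunc Fq) M]

variable (Fq) in
/-- The series `∑_i D_i⁻¹ τ ^ i` applied to a sequence `f`, considered as the formal sum of the
`f j Z ^ (q ^ j)`. -/
def expSeq (τ : M →+ M) (f : ℕ → M) (d : ℕ) : M :=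
  ∑ i ∈ Finset.range (d + 1),
    (algebraMap Fq[X] (RatFunc Fq) (carlitzD Fq i))⁻¹ • τ^[i] (f (d - i))

variable {τ : M →+ M}

theorem iterate_semilinear (hτ : ∀ (c : RatFunc Fq) (x : M), τ (c • x) = c ^ q • τ x)
    (i : ℕ) (c : RatFunc Fq) (x : M) : τ^[i] (c • x) = c ^ q ^ i • τ^[i] x := by
  induction i with
  | zero => simp
  | succ i ih => rw [Function.iterate_succ_apply', ih, hτ, Function.iterate_succ_apply', ← pow_mul,
      pow_succ]

theorem expSeq_add (f g : ℕ → M) : expSeq Fq τ (f + g) = expSeq Fq τ f + expSeq Fq τ g := by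
  funext d
  simp [expSeq, Pi.add_apply, iterate_map_add, smul_add, Finset.sum_add_distrib]

theorem expSeq_C_smul (hτ : ∀ (c : RatFunc Fq) (x : M), τ (c • x) = c ^ q • τ x)
    (c : Fq) (f : ℕ → M) (d : ℕ) :
    expSeq Fq τ (algebraMap Fq (RatFunc Fq) c • f) d =
      algebraMap Fq (RatFunc Fq) c • expSeq Fq τ f d := by
  simp only [expSeq, Pi.smul_apply, iterate_semilinear hτ, ← map_pow, FiniteField.pow_card_pow,
    Finset.smul_sum]
  exact Finset.sum_congr rfl fun i _ => smul_comm _ _ _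

theorem expSeq_X_smul_zero (f : ℕ → M) :
    expSeq Fq τ (algebraMap Fq[X] (RatFunc Fq) Polynomial.X • f) 0 =
      algebraMap Fq[X] (RatFunc Fq) Polynomial.X • expSeq Fq τ f 0 := by
  simp [expSeq, carlitzD]

/-- The recursion for D_i says that (θ^(q^(i+1)) - θ)/D_{i+1} = 1/D_i^q, which is the identity exp_C
θ = (θ + τ) exp_C. -/
theorem expSeq_X_smul_succ (hτ : ∀ (c : RatFunc Fq) (x : M), τ (c • x) = c ^ q • τ x)
    (f : ℕ → M) (d : ℕ) :
    expSeq Fq τ (algebraMap Fq[X] (RatFunc Fq) Polynomial.X • f) (d + 1) =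
      algebraMap Fq[X] (RatFunc Fq) Polynomial.X • expSeq Fq τ f (d + 1) + τ (expSeq Fq τ f d) := by
  simp only [expSeq, Pi.smul_apply, iterate_semilinear hτ, map_sum, hτ]
  rw [Finset.sum_range_succ', Finset.sum_range_succ' _ (d + 1), smul_add, add_right_comm,
    Finset.smul_sum, ← Finset.sum_add_distrib]
  congr 1
  · refine Finset.sum_congr rfl fun i _ => ?_
    rw [Nat.add_sub_add_right, ← Function.iterate_succ_apply' τ, smul_smul, smul_smul, ← add_smul]
    congr 1
    have h1 := carlitzD_ne_zero (Fq := Fq) (i + 1)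
    have h0 := carlitzD_ne_zero (Fq := Fq) i
    rw [carlitzD] at h1 ⊢
    have hinj := (IsFractionRing.injective Fq[X] (RatFunc Fq))
    rw [Ne, ← map_eq_zero_iff _ hinj] at h0 h1
    rw [map_mul, map_sub, map_pow, map_pow] at h1 ⊢
    generalize algebraMap Fq[X] (RatFunc Fq) Polynomial.X = t at *
    have h2 := left_ne_zero_of_mul h1
    have h3 : algebraMap Fq[X] (RatFunc Fq) (carlitzD Fq i) ^ q ≠ 0 := pow_ne_zero _ h0
    rw [inv_pow]
    generalize algebraMap Fq[X] (RatFunc Fq) (carlitzD Fq i) ^ q = e at *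
    field_simp
    ring
  · rw [pow_zero, pow_one]
    exact smul_comm _ _ _

/-- The relation exp_C a = C_a exp_C, obtained from the case a = θ. -/
theorem expSeq_smul (hτ : ∀ (c : RatFunc Fq) (x : M), τ (c • x) = c ^ q • τ x)
    (a : Fq[X]) (f : ℕ → M) (d : ℕ) :
    expSeq Fq τ (algebraMap Fq[X] (RatFunc Fq) a • f) d =
      ∑ i ∈ Finset.range (d + 1), algebraMap Fq[X] (RatFunc Fq) (carlitzCoeff a i) •
        τ^[i] (expSeq Fq τ f (d - i)) := by
  induction a using Polynomial.induction_on' generalizing d with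
  | add a b ha hb =>
    simp only [map_add, add_smul, expSeq_add, Pi.add_apply, ha, hb, carlitzCoeff_add,
      Finset.sum_add_distrib]
  | monomial n c =>
    induction n generalizing d with
    | zero =>
      rw [Polynomial.monomial_zero_left, carlitzCoeff_C, Finset.sum_eq_single 0]
      · have : Polynomial.C c = algebraMap Fq Fq[X] c := rfl
        rw [this, ← IsScalarTower.algebraMap_apply, expSeq_C_smul hτ, Pi.smul_apply,
          Pi.single_eq_same, ← Algebra.algebraMap_eq_smul_one, ← IsScalarTower.algebraMap_apply]
        simp
      · intro i _ hi
        simp [hi]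
      · simp
    | succ n ih =>
      have : Polynomial.monomial (n + 1) c = Polynomial.X * Polynomial.monomial n c := by
        rw [Polynomial.X_mul_monomial]
      rw [this, map_mul, mul_smul, carlitzCoeff_X_mul]
      cases d with
      | zero =>
        rw [expSeq_X_smul_zero, ih, Finset.sum_range_one, Finset.sum_range_one, carlitzLeft_zero,
          map_mul, mul_smul]
      | succ d =>
        rw [expSeq_X_smul_succ hτ, ih, ih, Finset.sum_range_succ', Finset.sum_range_succ' _ (d + 1),
          smul_add, add_right_comm, Finset.smul_sum, map_sum, ← Finset.sum_add_distrib]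
        congr 1
        · refine Finset.sum_congr rfl fun i _ => ?_
          rw [carlitzLeft_succ, map_add, map_mul, map_pow, add_smul, mul_smul, hτ,
            ← Function.iterate_succ_apply' τ, Nat.add_sub_add_right]
        · rw [carlitzLeft_zero, map_mul, mul_smul]

/-- The exponential commutes with Z ↦ Z^(q^h) combined with a linear N commuting with τ. It is used
for N = P(t_1)⋯P(t_s) and h = deg P. -/
theorem expSeq_shift {N : M →+ M} (hc : ∀ (c : RatFunc Fq) (x : M), N (c • x) = c • N x)
    (hN : ∀ x, τ (N x) = N (τ x)) (f : ℕ → M) (h d : ℕ) :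
    expSeq Fq τ (fun j => if h ≤ j then N (f (j - h)) else 0) d =
      if h ≤ d then N (expSeq Fq τ f (d - h)) else 0 := by
  have hi (i : ℕ) (x : M) : τ^[i] (N x) = N (τ^[i] x) := by
    induction i with
    | zero => rfl
    | succ i ih => rw [Function.iterate_succ_apply', ih, hN, Function.iterate_succ_apply']
  split_ifs with hd
  · simp only [expSeq, map_sum, hc]
    symm
    refine Finset.sum_subset_zero_on_sdiff (Finset.range_subset_range.mpr (by omega)) ?_ ?_
    · intro i hi
      simp only [Finset.mem_sdiff, Finset.mem_range] at hi
      rw [if_neg (by omega), iterate_map_zero, smul_zero]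
    · intro i hi'
      rw [Finset.mem_range] at hi'
      rw [if_pos (by omega), hi, Nat.sub_right_comm]
  · refine Finset.sum_eq_zero fun i _ => ?_
    simp only [if_neg (show ¬ h ≤ d - i by omega), iterate_map_zero, smul_zero]

end Exponential

/-! ### Gauss norm bounds for polynomials -/

section Gauss

variable {σ F Γ : Type*} [Field F] [LinearOrderedCommGroupWithZero Γ]

/-- The Gauss norm of `G` with respect to `v` is at most `γ`. -/
def GaussLE (v : Valuation F Γ) (G : MvPolynomial σ F) (γ : Γ) : Prop :=
  ∀ m, v (G.coeff m) ≤ γ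

namespace GaussLE

variable {v : Valuation F Γ} {G H : MvPolynomial σ F} {γ δ : Γ}

theorem mono (hG : GaussLE v G γ) (h : γ ≤ δ) : GaussLE v G δ := fun m => (hG m).trans h

theorem zero : GaussLE v (0 : MvPolynomial σ F) γ := fun m => by simp

theorem add (hG : GaussLE v G γ) (hH : GaussLE v H γ) : GaussLE v (G + H) γ := fun m => by
  rw [MvPolynomial.coeff_add]
  exact v.map_add_le (hG m) (hH m)

theorem sub (hG : GaussLE v G γ) (hH : GaussLE v H γ) : GaussLE v (G - H) γ := fun m => by
  rw [MvPolynomial.coeff_sub]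
  exact v.map_sub_le (hG m) (hH m)

theorem sum {ι : Type*} {s : Finset ι} {G : ι → MvPolynomial σ F}
    (hG : ∀ i ∈ s, GaussLE v (G i) γ) : GaussLE v (∑ i ∈ s, G i) γ := fun m => by
  rw [MvPolynomial.coeff_sum]
  exact v.map_sum_le fun i hi => hG i hi m

theorem mul (hG : GaussLE v G γ) (hH : GaussLE v H δ) : GaussLE v (G * H) (γ * δ) := fun m => by
  classical
  rw [MvPolynomial.coeff_mul]
  refine v.map_sum_le fun i _ => ?_
  rw [map_mul]
  exact mul_le_mul' (hG _) (hH _)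

theorem C {c : F} (h : v c ≤ γ) : GaussLE v (MvPolynomial.C c : MvPolynomial σ F) γ := fun m => by
  classical
  rw [MvPolynomial.coeff_C]
  split_ifs
  · exact h
  · simp

theorem smul {c : F} (hc : v c ≤ δ) (hG : GaussLE v G γ) : GaussLE v (c • G) (δ * γ) := fun m => by
  rw [MvPolynomial.coeff_smul, smul_eq_mul, map_mul]
  exact mul_le_mul' hc (hG m)

theorem of_smul {c : F} (hc : c ≠ 0) (hG : GaussLE v (c • G) (v c)) : GaussLE v G 1 := fun m => by
  have := hG m
  rw [MvPolynomial.coeff_smul, smul_eq_mul, map_mul] at this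
  exact (mul_le_iff_le_one_right (zero_lt_iff.mpr ((v.ne_zero_iff).mpr hc))).mp this

theorem X (k : σ) : GaussLE v (MvPolynomial.X k : MvPolynomial σ F) 1 := fun m => by
  classical
  rw [MvPolynomial.coeff_X]
  split_ifs <;> simp

theorem one : GaussLE v (1 : MvPolynomial σ F) 1 := by
  rw [← map_one MvPolynomial.C]
  exact C (by simp)

theorem prod {ι : Type*} {s : Finset ι} {G : ι → MvPolynomial σ F} {γ : ι → Γ}
    (hG : ∀ i ∈ s, GaussLE v (G i) (γ i)) : GaussLE v (∏ i ∈ s, G i) (∏ i ∈ s, γ i) := by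
  classical
  induction s using Finset.induction_on with
  | empty => simpa using one
  | insert a s ha ih =>
    rw [Finset.prod_insert ha, Finset.prod_insert ha]
    exact (hG a (Finset.mem_insert_self a s)).mul
      (ih fun i hi => hG i (Finset.mem_insert_of_mem hi))

theorem prod_le_one {ι : Type*} {s : Finset ι} {G : ι → MvPolynomial σ F}
    (hG : ∀ i ∈ s, GaussLE v (G i) 1) : GaussLE v (∏ i ∈ s, G i) 1 := by
  simpa using prod hG

/-- Telescoping: replace the factors one at a time, the others having norm at most 1. -/
theorem prod_sub_prod {ι : Type*} {s : Finset ι} {G H : ι → MvPolynomial σ F}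
    (hG : ∀ i ∈ s, GaussLE v (G i) 1) (hH : ∀ i ∈ s, GaussLE v (H i) 1)
    (hGH : ∀ i ∈ s, GaussLE v (G i - H i) γ) :
    GaussLE v (∏ i ∈ s, G i - ∏ i ∈ s, H i) γ := by
  classical
  induction s using Finset.induction_on with
  | empty => simpa using zero
  | insert a s ha ih =>
    rw [Finset.prod_insert ha, Finset.prod_insert ha]
    simp only [Finset.forall_mem_insert] at hG hH hGH
    have : G a * ∏ i ∈ s, G i - H a * ∏ i ∈ s, H i =
        G a * (∏ i ∈ s, G i - ∏ i ∈ s, H i) + (G a - H a) * ∏ i ∈ s, H i := by ring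
    rw [this]
    refine add ?_ ?_
    · simpa using hG.1.mul (ih hG.2 hH.2 hGH.2)
    · simpa using hGH.1.mul (prod_le_one hH.2)

theorem map_of_pow {f : F →+* F} {n : ℕ} (hf : ∀ x, f x = x ^ n) (hG : GaussLE v G γ) :
    GaussLE v (MvPolynomial.map f G) (γ ^ n) := fun m => by
  rw [MvPolynomial.coeff_map, hf, map_pow]
  exact pow_le_pow_left₀ zero_le (hG m) n

end GaussLE

end Gauss
end AndersonStark

end

noncomputable section

namespace AndersonStark

/-! ### The operator τ on K[t_1, …, t_s] and the twisted power sums -/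

section Twisted

variable {Fq : Type*} [Field Fq] [Fintype Fq]

local notation "q" => Fintype.card Fq

variable (Fq) in
theorem finite_setOf_monic_natDegree_eq (d : ℕ) :
    {a : Fq[X] | a.Monic ∧ a.natDegree = d}.Finite := by
  have : Finite (Polynomial.degreeLT Fq (d + 1)) :=
    Finite.of_equiv _ (Polynomial.degreeLTEquiv Fq (d + 1)).symm.toEquiv
  refine (Set.toFinite (Polynomial.degreeLT Fq (d + 1) : Set Fq[X])).subset fun a ha => ?_
  rw [SetLike.mem_coe, Polynomial.mem_degreeLT]
  refine lt_of_le_of_lt Polynomial.degree_le_natDegree ?_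
  rw [ha.2]
  exact_mod_cast Nat.lt_succ_self d

variable (Fq) in
/-- The monic polynomials of degree `d`. -/
def monics (d : ℕ) : Finset Fq[X] := (finite_setOf_monic_natDegree_eq Fq d).toFinset

@[simp] theorem mem_monics {d : ℕ} {a : Fq[X]} :
    a ∈ monics Fq d ↔ a.Monic ∧ a.natDegree = d := by simp [monics]

variable {σ : Type*} [Fintype σ]

variable (Fq σ) in
/-- The semilinear operator on `K[t_1, …, t_s]` that corresponds to the `q`-th power map on the
polynomials in `X_1, …, X_s` which are `Fq`-linear in each variable. -/
def tau : MvPolynomial σ (RatFunc Fq) →+ MvPolynomial σ (RatFunc Fq) :=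
  (AddMonoidHom.mulLeft (∏ k, carlitzBasis Fq (MvPolynomial.X k) 1)).comp
    (MvPolynomial.map (frobeniusPow Fq (RatFunc Fq) 1).toRingHom).toAddMonoidHom

theorem tau_apply (F : MvPolynomial σ (RatFunc Fq)) :
    tau Fq σ F = (∏ k, carlitzBasis Fq (MvPolynomial.X k) 1) *
      MvPolynomial.map (frobeniusPow Fq (RatFunc Fq) 1).toRingHom F := rfl

theorem tau_smul (c : RatFunc Fq) (F : MvPolynomial σ (RatFunc Fq)) :
    tau Fq σ (c • F) = c ^ q • tau Fq σ F := by
  rw [tau_apply, tau_apply, MvPolynomial.smul_eq_C_mul, map_mul, MvPolynomial.map_C,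
    MvPolynomial.smul_eq_C_mul, mul_left_comm]
  congr 3

/-- The coefficients of a(t_k) lie in Fq, which Frobenius fixes. Hence multiplication by
a(t_1)⋯a(t_s) commutes with τ. -/
theorem map_frobeniusPow_aeval (i : ℕ) (k : σ) (a : Fq[X]) :
    MvPolynomial.map (frobeniusPow Fq (RatFunc Fq) i).toRingHom
      (Polynomial.aeval (MvPolynomial.X k) a) = Polynomial.aeval (MvPolynomial.X k) a := by
  have := Polynomial.aeval_algHom_apply
    (MvPolynomial.mapAlgHom (σ := σ) (frobeniusPow Fq (RatFunc Fq) i)) (MvPolynomial.X k) a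
  rw [MvPolynomial.mapAlgHom_apply, MvPolynomial.map_X] at this
  exact this.symm

theorem tau_iterate (i : ℕ) (F : MvPolynomial σ (RatFunc Fq)) :
    (tau Fq σ)^[i] F = (∏ k, carlitzBasis Fq (MvPolynomial.X k) i) *
      MvPolynomial.map (frobeniusPow Fq (RatFunc Fq) i).toRingHom F := by
  induction i with
  | zero =>
    ext
    simp [carlitzBasis, frobeniusPow, MvPolynomial.coeff_map]
  | succ i ih =>
    rw [Function.iterate_succ_apply', ih, tau_apply, map_mul, map_prod, ← mul_assoc,
      ← Finset.prod_mul_distrib]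
    congr 1
    · refine Finset.prod_congr rfl fun k _ => ?_
      simp only [carlitzBasis, map_prod, map_sub, MvPolynomial.map_X]
      rw [Finset.prod_range_one, mul_comm, Finset.prod_range_succ']
      congr 1
      refine Finset.prod_congr rfl fun j _ => ?_
      rw [MvPolynomial.algebraMap_apply, MvPolynomial.algebraMap_apply, MvPolynomial.map_C]
      congr 2
      refine (frobeniusPow_apply 1 _).trans ?_
      rw [pow_one, ← map_pow, ← pow_mul, pow_succ]
    · ext m
      rw [MvPolynomial.coeff_map, MvPolynomial.coeff_map, MvPolynomial.coeff_map]
      have h (i : ℕ) (x : RatFunc Fq) :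
        (frobeniusPow Fq (RatFunc Fq) i).toRingHom x = x ^ q ^ i := frobeniusPow_apply i x
      rw [h, h, h, ← pow_mul, ← pow_add]

variable (σ) in
/-- The product `a(t_1) ⋯ a(t_s)`. -/
def twistedProd (a : Fq[X]) : MvPolynomial σ (RatFunc Fq) :=
  ∏ k, Polynomial.aeval (MvPolynomial.X k) a

theorem tau_twistedProd_mul (a : Fq[X]) (F : MvPolynomial σ (RatFunc Fq)) :
    tau Fq σ (twistedProd σ a * F) = twistedProd σ a * tau Fq σ F := by
  simp only [tau_apply, map_mul, twistedProd, map_prod, map_frobeniusPow_aeval]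
  ring

theorem twistedProd_mul (a b : Fq[X]) :
    twistedProd σ (a * b) = twistedProd σ a * twistedProd σ b := by
  simp [twistedProd, Finset.prod_mul_distrib]

variable (σ) in
/-- The sum of `a(t_1) ⋯ a(t_s) / a` over a finite set of polynomials. -/
def twistedSum (T : Finset Fq[X]) : MvPolynomial σ (RatFunc Fq) :=
  ∑ a ∈ T, (algebraMap Fq[X] (RatFunc Fq) a)⁻¹ • twistedProd σ a

-- The monic multiples of P of degree d are the P b with b monic of degree d - deg P, and the factor
-- P cancels the one in the denominator.
open Classical in
theorem smul_twistedSum_monics {P : Fq[X]} (hP : P.Monic) (d : ℕ) :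
    algebraMap Fq[X] (RatFunc Fq) P • twistedSum σ (monics Fq d) =
      algebraMap Fq[X] (RatFunc Fq) P • twistedSum σ ((monics Fq d).filter (¬ P ∣ ·)) +
      if P.natDegree ≤ d then twistedProd σ P * twistedSum σ (monics Fq (d - P.natDegree)) else 0 := by
  have hP0 : algebraMap Fq[X] (RatFunc Fq) P ≠ 0 :=
    (map_ne_zero_iff _ (IsFractionRing.injective Fq[X] (RatFunc Fq))).mpr hP.ne_zero
  rw [twistedSum, twistedSum, ← Finset.sum_filter_add_sum_filter_not _ (¬ P ∣ ·), smul_add]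
  congr 1
  simp only [not_not]
  split_ifs with h
  · rw [twistedSum, Finset.smul_sum, Finset.mul_sum]
    symm
    refine Finset.sum_bij (fun b _ => P * b) ?_ ?_ ?_ ?_
    · intro b hb
      rw [mem_monics] at hb
      rw [Finset.mem_filter, mem_monics, hP.natDegree_mul hb.1]
      exact ⟨⟨hP.mul hb.1, by omega⟩, dvd_mul_right _ _⟩
    · intro b _ c _ hbc
      exact mul_left_cancel₀ hP.ne_zero hbc
    · intro a ha
      rw [Finset.mem_filter, mem_monics] at ha
      obtain ⟨⟨ha1, ha2⟩, b, rfl⟩ := ha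
      have hb := hP.of_mul_monic_left ha1
      rw [hP.natDegree_mul hb] at ha2
      exact ⟨b, by rw [mem_monics]; exact ⟨hb, by omega⟩, rfl⟩
    · intro b _
      rw [map_mul, mul_inv, smul_smul, mul_inv_cancel_left₀ hP0, twistedProd_mul, mul_smul_comm]
  · rw [Finset.sum_eq_zero, smul_zero]
    intro a ha
    rw [Finset.mem_filter, mem_monics] at ha
    exact absurd (Polynomial.natDegree_le_of_dvd ha.2 ha.1.1.ne_zero) (by omega)

variable (Fq σ) in
/-- The coefficient of `Z ^ (q ^ d)` in the special series, with the polynomials in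
`X_1, …, X_s` replaced by operators in `t_1, …, t_s`. -/
def starkCoeff (d : ℕ) : MvPolynomial σ (RatFunc Fq) :=
  expSeq Fq (tau Fq σ) (fun j => twistedSum σ (monics Fq j)) d

-- C_P applied to the exponential, computed through the splitting of the power sums by divisibility
-- by P. This drives the induction for integrality at P.
open Classical in
theorem sum_carlitzCoeff_smul_starkCoeff {P : Fq[X]} (hP : P.Monic) (d : ℕ) :
    ∑ i ∈ Finset.range (d + 1), algebraMap Fq[X] (RatFunc Fq) (carlitzCoeff P i) •
        (tau Fq σ)^[i] (starkCoeff Fq σ (d - i)) =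
      expSeq Fq (tau Fq σ) (algebraMap Fq[X] (RatFunc Fq) P •
        fun j => twistedSum σ ((monics Fq j).filter (¬ P ∣ ·))) d +
      if P.natDegree ≤ d then twistedProd σ P * starkCoeff Fq σ (d - P.natDegree) else 0 := by
  have h := expSeq_smul tau_smul P (fun j => twistedSum σ (monics Fq j)) d
  have h2 := expSeq_shift (τ := tau Fq σ) (N := AddMonoidHom.mulLeft (twistedProd σ P))
    (fun (c : RatFunc Fq) x => mul_smul_comm c _ x) (fun x => tau_twistedProd_mul P x)
    (fun j => twistedSum σ (monics Fq j)) P.natDegree d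
  simp only [AddMonoidHom.coe_mulLeft] at h2
  simp only [starkCoeff]
  rw [← h, ← h2, ← Pi.add_apply, ← expSeq_add]
  congr 1
  funext j
  exact smul_twistedSum_monics hP j

section Bounds

variable {Γ : Type*} [LinearOrderedCommGroupWithZero Γ] {v : Valuation (RatFunc Fq) Γ}

theorem valuation_constant_le_one (v : Valuation (RatFunc Fq) Γ) (c : Fq) :
    v (algebraMap Fq (RatFunc Fq) c) ≤ 1 := by
  by_contra! h
  have h2 : v (algebraMap Fq (RatFunc Fq) c) ^ q = v (algebraMap Fq (RatFunc Fq) c) := by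
    rw [← map_pow, ← map_pow, FiniteField.pow_card]
  exact (lt_self_pow₀ h Fintype.one_lt_card).ne' h2

theorem gaussLE_aeval (v : Valuation (RatFunc Fq) Γ) (k : σ) (a : Fq[X]) :
    GaussLE v (Polynomial.aeval (MvPolynomial.X k : MvPolynomial σ (RatFunc Fq)) a) 1 := by
  rw [Polynomial.aeval_eq_sum_range]
  refine GaussLE.sum fun i _ => ?_
  rw [Algebra.smul_def, MvPolynomial.algebraMap_apply]
  have h1 : GaussLE v ((MvPolynomial.X k : MvPolynomial σ (RatFunc Fq)) ^ i) 1 := by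
    have := GaussLE.prod_le_one (s := Finset.range i) fun _ _ => GaussLE.X (v := v) k
    simpa using this
  simpa using (GaussLE.C (valuation_constant_le_one v (a.coeff i))).mul h1

theorem gaussLE_twistedProd (v : Valuation (RatFunc Fq) Γ) (a : Fq[X]) :
    GaussLE v (twistedProd σ a) 1 := GaussLE.prod_le_one fun k _ => gaussLE_aeval v k a

theorem gaussLE_carlitzBasis {β : ℕ → Γ} (hβ : ∀ j, 1 ≤ β j)
    (hv : ∀ j, v (algebraMap Fq[X] (RatFunc Fq) (Polynomial.X ^ q ^ j)) ≤ β j) (k : σ) (i : ℕ) :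
    GaussLE v (carlitzBasis Fq (MvPolynomial.X k : MvPolynomial σ (RatFunc Fq)) i)
      (∏ j ∈ Finset.range i, β j) :=
  GaussLE.prod fun j _ => ((GaussLE.X k).mono (hβ j)).sub (GaussLE.C (hv j))

theorem gaussLE_tau_iterate {β : ℕ → Γ} (hβ : ∀ j, 1 ≤ β j)
    (hv : ∀ j, v (algebraMap Fq[X] (RatFunc Fq) (Polynomial.X ^ q ^ j)) ≤ β j)
    {F : MvPolynomial σ (RatFunc Fq)} {γ : Γ} (hF : GaussLE v F γ) (i : ℕ) :
    GaussLE v ((tau Fq σ)^[i] F)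
      ((∏ j ∈ Finset.range i, β j) ^ Fintype.card σ * γ ^ q ^ i) := by
  rw [tau_iterate]
  have := GaussLE.prod (s := (Finset.univ : Finset σ))
    fun k _ => gaussLE_carlitzBasis hβ hv k i
  rw [Finset.prod_const, Finset.card_univ] at this
  exact this.mul (hF.map_of_pow fun x => frobeniusPow_apply i x)

end Bounds

end Twisted
end AndersonStark

end

noncomputable section

namespace AndersonStark

open IsDedekindDomain

variable {Fq : Type*} [Field Fq] [Fintype Fq]

local notation "q" => Fintype.card Fq

/-! ### Integrality at the finite places -/

section FinitePlaces

theorem exists_monic_irreducible_span {k : Type*} [Field k] (v : HeightOneSpectrum k[X]) :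
    ∃ P : k[X], P.Monic ∧ Irreducible P ∧ v.asIdeal = Ideal.span {P} := by
  classical
  obtain ⟨g, hg⟩ := (IsPrincipalIdealRing.principal v.asIdeal).principal
  rw [Ideal.submodule_span_eq] at hg
  have hg0 : g ≠ 0 := by
    rintro rfl
    exact v.ne_bot (by simpa using hg)
  have hs : v.asIdeal = Ideal.span {normalize g} := by
    rw [hg, Ideal.span_singleton_eq_span_singleton]
    exact (normalize_associated g).symm
  refine ⟨normalize g, Polynomial.monic_normalize hg0, ?_, hs⟩
  have := v.isPrime
  rw [hs, Ideal.span_singleton_prime (by simpa using hg0)] at this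
  exact this.irreducible

theorem valuation_eq_one_of_not_dvd {v : HeightOneSpectrum Fq[X]} {P : Fq[X]}
    (hv : v.asIdeal = Ideal.span {P}) {a : Fq[X]} (h : ¬ P ∣ a) :
    v.valuation (RatFunc Fq) (algebraMap Fq[X] (RatFunc Fq) a) = 1 := by
  rw [HeightOneSpectrum.valuation_eq_one_iff_notMem, hv, Ideal.mem_span_singleton]
  exact h

theorem valuation_le_of_dvd (v : HeightOneSpectrum Fq[X]) {P a : Fq[X]} (h : P ∣ a) :
    v.valuation (RatFunc Fq) (algebraMap Fq[X] (RatFunc Fq) a) ≤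
      v.valuation (RatFunc Fq) (algebraMap Fq[X] (RatFunc Fq) P) := by
  obtain ⟨b, rfl⟩ := h
  rw [map_mul, map_mul]
  exact mul_le_of_le_one_right' (v.valuation_le_one b)

variable (Fq) in
theorem squarefree_X_pow_card_pow_sub_X (n : ℕ) (hn : n ≠ 0) :
    Squarefree (Polynomial.X ^ q ^ n - Polynomial.X : Fq[X]) := by
  obtain ⟨p, hp⟩ := CharP.exists Fq
  refine (galois_poly_separable p _ (dvd_pow ?_ hn)).squarefree
  rw [← CharP.cast_eq_zero_iff Fq, FiniteField.cast_card_eq_zero]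

/-- P divides θ^(q^n) - θ at most once, by squarefreeness. -/
theorem valuation_le_valuation_X_pow_card_pow_sub_X {v : HeightOneSpectrum Fq[X]} {P : Fq[X]}
    (hP : Irreducible P) (hv : v.asIdeal = Ideal.span {P}) {n : ℕ} (hn : n ≠ 0) :
    v.valuation (RatFunc Fq) (algebraMap Fq[X] (RatFunc Fq) P) ≤
      v.valuation (RatFunc Fq) (algebraMap Fq[X] (RatFunc Fq)
        (Polynomial.X ^ q ^ n - Polynomial.X)) := by
  by_cases h : P ∣ Polynomial.X ^ q ^ n - Polynomial.X
  · obtain ⟨b, hb⟩ := h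
    have hPb : ¬ P ∣ b := fun h2 => hP.not_isUnit
      (squarefree_X_pow_card_pow_sub_X Fq n hn P (hb ▸ mul_dvd_mul_left P h2))
    rw [hb, map_mul, map_mul, valuation_eq_one_of_not_dvd hv hPb, mul_one]
  · rw [valuation_eq_one_of_not_dvd hv h]
    exact v.valuation_le_one P

/-- Additively, ord_P D_i ≤ q^i - 1; inductively 1 + q(q^i - 1) ≤ q^(i+1) - 1, as q ≥ 2. -/
theorem valuation_pow_le_carlitzD {v : HeightOneSpectrum Fq[X]} {P : Fq[X]}
    (hP : Irreducible P) (hv : v.asIdeal = Ideal.span {P}) (i : ℕ) :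
    v.valuation (RatFunc Fq) (algebraMap Fq[X] (RatFunc Fq) P) ^ q ^ i ≤
      v.valuation (RatFunc Fq) (algebraMap Fq[X] (RatFunc Fq) (carlitzD Fq i)) *
        v.valuation (RatFunc Fq) (algebraMap Fq[X] (RatFunc Fq) P) := by
  have hP1 : v.valuation (RatFunc Fq) (algebraMap Fq[X] (RatFunc Fq) P) ≤ 1 := v.valuation_le_one P
  induction i with
  | zero => simp [carlitzD]
  | succ i ih =>
    have h := valuation_le_valuation_X_pow_card_pow_sub_X hP hv i.succ_ne_zero
    rw [carlitzD, map_mul, map_mul, map_pow, map_pow]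
    generalize v.valuation (RatFunc Fq) (algebraMap Fq[X] (RatFunc Fq) P) = x at *
    generalize v.valuation (RatFunc Fq) (algebraMap Fq[X] (RatFunc Fq) (carlitzD Fq i)) = y at *
    generalize v.valuation (RatFunc Fq) (algebraMap Fq[X] (RatFunc Fq)
        (Polynomial.X ^ q ^ (i + 1) - Polynomial.X)) = z at *
    calc x ^ q ^ (i + 1) = (x ^ q ^ i) ^ q := by rw [← pow_mul, pow_succ]
      _ ≤ (y * x) ^ q := pow_le_pow_left₀ zero_le ih q
      _ = x ^ q * y ^ q := by rw [mul_pow, mul_comm]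
      _ ≤ x ^ 2 * y ^ q :=
        mul_le_mul_left (pow_le_pow_of_le_one zero_le hP1 Fintype.one_lt_card) _
      _ = x * y ^ q * x := by rw [pow_two, mul_right_comm]
      _ ≤ z * y ^ q * x := mul_le_mul_left (mul_le_mul_left h _) _

variable {σ : Type*} [Fintype σ]

theorem gaussLE_tau_iterate_valuation (v : HeightOneSpectrum Fq[X])
    {F : MvPolynomial σ (RatFunc Fq)} {γ : WithZero (Multiplicative ℤ)}
    (hF : GaussLE (v.valuation (RatFunc Fq)) F γ) (i : ℕ) :
    GaussLE (v.valuation (RatFunc Fq)) ((tau Fq σ)^[i] F) (γ ^ q ^ i) := by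
  simpa using gaussLE_tau_iterate (β := fun _ => 1) (fun _ => le_rfl)
    (fun j => v.valuation_le_one (Polynomial.X ^ q ^ j)) hF i

open Classical in
theorem gaussLE_twistedSum_filter {v : HeightOneSpectrum Fq[X]} {P : Fq[X]}
    (hv : v.asIdeal = Ideal.span {P}) (T : Finset Fq[X]) :
    GaussLE (v.valuation (RatFunc Fq)) (twistedSum σ (T.filter (¬ P ∣ ·))) 1 := by
  refine GaussLE.sum fun a ha => ?_
  have := valuation_eq_one_of_not_dvd hv (Finset.mem_filter.mp ha).2
  simpa using GaussLE.smul (v := v.valuation (RatFunc Fq))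
    (show v.valuation (RatFunc Fq) (algebraMap Fq[X] (RatFunc Fq) a)⁻¹ ≤ 1 by
      rw [map_inv₀, this, inv_one])
    (gaussLE_twistedProd (σ := σ) _ a)

-- The terms prime to P are integral; the factor P becomes P^(q^i) under τ^i, enough to absorb D_i
-- and leave one P.
open Classical in
theorem gaussLE_expSeq_twistedSum_filter {v : HeightOneSpectrum Fq[X]} {P : Fq[X]}
    (hP : Irreducible P) (hv : v.asIdeal = Ideal.span {P}) (d : ℕ) :
    GaussLE (v.valuation (RatFunc Fq)) (expSeq Fq (tau Fq σ) (algebraMap Fq[X] (RatFunc Fq) P •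
        fun j => twistedSum σ ((monics Fq j).filter (¬ P ∣ ·))) d)
      (v.valuation (RatFunc Fq) (algebraMap Fq[X] (RatFunc Fq) P)) := by
  refine GaussLE.sum fun i _ => ?_
  have h1 := gaussLE_twistedSum_filter (σ := σ) hv (monics Fq (d - i))
  have h2 := gaussLE_tau_iterate_valuation v
    (h1.smul (c := algebraMap Fq[X] (RatFunc Fq) P) le_rfl) i
  rw [mul_one] at h2
  have h3 := h2.smul (c := (algebraMap Fq[X] (RatFunc Fq) (carlitzD Fq i))⁻¹) le_rfl
  refine h3.mono ?_
  have hD : v.valuation (RatFunc Fq) (algebraMap Fq[X] (RatFunc Fq) (carlitzD Fq i)) ≠ 0 := by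
    rw [Valuation.ne_zero_iff, map_ne_zero_iff _ (IsFractionRing.injective Fq[X] (RatFunc Fq))]
    exact carlitzD_ne_zero i
  rw [map_inv₀, inv_mul_le_iff₀ (zero_lt_iff.mpr hD)]
  exact valuation_pow_le_carlitzD hP hv i

theorem exists_algebraMap_of_gaussLE {G : MvPolynomial σ (RatFunc Fq)}
    (hG : ∀ v : HeightOneSpectrum Fq[X], GaussLE (v.valuation (RatFunc Fq)) G 1) (m : σ →₀ ℕ) :
    ∃ a : Fq[X], algebraMap Fq[X] (RatFunc Fq) a = G.coeff m :=
  HeightOneSpectrum.mem_integers_of_valuation_le_one _ _ fun v => hG v m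

theorem gaussLE_frobenius_sub {v : HeightOneSpectrum Fq[X]} {P : Fq[X]}
    (hP : Irreducible P) {G : MvPolynomial σ (RatFunc Fq)}
    (hG : ∀ m, ∃ a : Fq[X], algebraMap Fq[X] (RatFunc Fq) a = G.coeff m) :
    GaussLE (v.valuation (RatFunc Fq))
      (MvPolynomial.map (frobeniusPow Fq (RatFunc Fq) P.natDegree).toRingHom G - G)
      (v.valuation (RatFunc Fq) (algebraMap Fq[X] (RatFunc Fq) P)) := by
  intro m
  obtain ⟨a, ha⟩ := hG m
  have h : (frobeniusPow Fq (RatFunc Fq) P.natDegree).toRingHom (G.coeff m) =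
      G.coeff m ^ q ^ P.natDegree := frobeniusPow_apply _ _
  rw [MvPolynomial.coeff_sub, MvPolynomial.coeff_map, h, ← ha, ← map_pow, ← map_sub]
  exact valuation_le_of_dvd v (dvd_pow_card_pow_natDegree_sub hP a)

theorem gaussLE_carlitzBasis_valuation (v : HeightOneSpectrum Fq[X]) (k : σ) (i : ℕ) :
    GaussLE (v.valuation (RatFunc Fq))
      (carlitzBasis Fq (MvPolynomial.X k : MvPolynomial σ (RatFunc Fq)) i) 1 := by
  simpa using gaussLE_carlitzBasis (β := fun _ => 1) (fun _ => le_rfl)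
    (fun j => v.valuation_le_one (Polynomial.X ^ q ^ j)) k i

/-- In the expansion of P(t_k) along the b_i, the leading coefficient is 1 and the others are
divisible by P. -/
theorem gaussLE_carlitzBasis_sub_aeval (v : HeightOneSpectrum Fq[X]) {P : Fq[X]} (hP1 : P.Monic)
    (hP : Irreducible P) (k : σ) :
    GaussLE (v.valuation (RatFunc Fq))
      (carlitzBasis Fq (MvPolynomial.X k : MvPolynomial σ (RatFunc Fq)) P.natDegree -
        Polynomial.aeval (MvPolynomial.X k) P)
      (v.valuation (RatFunc Fq) (algebraMap Fq[X] (RatFunc Fq) P)) := by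
  rw [aeval_eq_sum_carlitzCoeff (MvPolynomial.X k) le_rfl, Finset.sum_range_succ,
    carlitzCoeff_of_natDegree_le le_rfl, hP1.coeff_natDegree, map_one, one_smul, sub_add_cancel_right,
    ← zero_sub]
  refine GaussLE.zero.sub (GaussLE.sum fun i hi => ?_)
  have h := valuation_le_of_dvd v (dvd_carlitzCoeff hP (Finset.mem_range.mp hi))
  rw [← algebraMap_smul (RatFunc Fq)]
  simpa using GaussLE.smul h (gaussLE_carlitzBasis_valuation v k i)

/-- Modulo P, Frobenius to the power deg P fixes coefficients in A, and b_{deg P}(t_k) is P(t_k).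
Integrality at every place is needed, to know that the coefficients lie in A. -/
theorem gaussLE_tau_sub {v : HeightOneSpectrum Fq[X]} {P : Fq[X]} (hP1 : P.Monic)
    (hP : Irreducible P) {G : MvPolynomial σ (RatFunc Fq)}
    (hG : ∀ v : HeightOneSpectrum Fq[X], GaussLE (v.valuation (RatFunc Fq)) G 1) :
    GaussLE (v.valuation (RatFunc Fq)) ((tau Fq σ)^[P.natDegree] G - twistedProd σ P * G)
      (v.valuation (RatFunc Fq) (algebraMap Fq[X] (RatFunc Fq) P)) := by
  rw [tau_iterate]
  have h1 := gaussLE_frobenius_sub (v := v) hP (exists_algebraMap_of_gaussLE hG)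
  have h2 := GaussLE.prod_sub_prod (s := (Finset.univ : Finset σ))
    (fun k _ => gaussLE_carlitzBasis_valuation v k P.natDegree)
    (fun k _ => gaussLE_aeval (v.valuation (RatFunc Fq)) k P)
    (fun k _ => gaussLE_carlitzBasis_sub_aeval v hP1 hP k)
  have h3 := (GaussLE.prod_le_one (s := (Finset.univ : Finset σ))
    (fun k _ => gaussLE_carlitzBasis_valuation v k P.natDegree)).mul h1
  have h4 := h2.mul (hG v)
  rw [one_mul] at h3
  rw [mul_one] at h4
  convert! h3.add h4 using 1
  rw [twistedProd]
  ring

theorem gaussLE_starkCoeff (d : ℕ) (v : HeightOneSpectrum Fq[X]) :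
    GaussLE (v.valuation (RatFunc Fq)) (starkCoeff Fq σ d) 1 := by
  classical
  induction d using Nat.strong_induction_on generalizing v with
  | _ d ih =>
  obtain ⟨P, hP1, hP, hv⟩ := exists_monic_irreducible_span v
  refine GaussLE.of_smul (c := algebraMap Fq[X] (RatFunc Fq) P)
    ((map_ne_zero_iff _ (IsFractionRing.injective Fq[X] (RatFunc Fq))).mpr hP1.ne_zero) ?_
  have hmain := sum_carlitzCoeff_smul_starkCoeff (σ := σ) hP1 d
  have hE := gaussLE_expSeq_twistedSum_filter (σ := σ) hP hv d
  rw [Finset.sum_range_succ', carlitzCoeff_zero, Function.iterate_zero, id_eq, Nat.sub_zero] at hmain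
  -- The i = 0 term of C_P is P times the unknown coefficient; all others involve smaller d.
  rw [eq_sub_of_add_eq' hmain, add_sub_assoc]
  refine hE.add ?_
  have hpos := hP.natDegree_pos
  have hsmall : ∀ i < d, i + 1 ≠ P.natDegree → GaussLE (v.valuation (RatFunc Fq))
      (algebraMap Fq[X] (RatFunc Fq) (carlitzCoeff P (i + 1)) •
        (tau Fq σ)^[i + 1] (starkCoeff Fq σ (d - (i + 1))))
      (v.valuation (RatFunc Fq) (algebraMap Fq[X] (RatFunc Fq) P)) := by
    intro i hi hne
    rcases hne.lt_or_gt with h | h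
    · have h1 := gaussLE_tau_iterate_valuation v (ih (d - (i + 1)) (by omega) v) (i + 1)
      rw [one_pow] at h1
      simpa using GaussLE.smul (valuation_le_of_dvd v (dvd_carlitzCoeff hP h)) h1
    · rw [carlitzCoeff_of_natDegree_le h.le, Polynomial.coeff_eq_zero_of_natDegree_lt h]
      simpa using GaussLE.zero
  -- Pairs the leading term y = τ^(deg P) of C_P with the shifted term x, so that their difference
  -- is small.
  have hkey (x y z : MvPolynomial σ (RatFunc Fq)) : x - (y + z) = 0 - (y - x) - z := by ring
  split_ifs with hd
  · have hmem : P.natDegree - 1 ∈ Finset.range d := by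
      rw [Finset.mem_range]
      omega
    have h1 : P.natDegree - 1 + 1 = P.natDegree := by omega
    rw [← Finset.add_sum_erase _ _ hmem, h1, carlitzCoeff_of_natDegree_le le_rfl,
      hP1.coeff_natDegree, map_one, map_one, one_smul, hkey]
    refine (GaussLE.zero.sub (gaussLE_tau_sub hP1 hP (ih _ (by omega)))).sub
      (GaussLE.sum fun i hi => ?_)
    rw [Finset.mem_erase, Finset.mem_range] at hi
    exact hsmall i hi.2 (by omega)
  · refine GaussLE.zero.sub (GaussLE.sum fun i hi => ?_)
    rw [Finset.mem_range] at hi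
    exact hsmall i hi (by omega)

end FinitePlaces

/-! ### Vanishing by the degree in θ -/

section Infinity

open WithZero

open Classical in
theorem inftyValuation_algebraMap {a : Fq[X]} (ha : a ≠ 0) :
    RatFunc.inftyValuation Fq (algebraMap Fq[X] (RatFunc Fq) a) = exp (a.natDegree : ℤ) :=
  RatFunc.inftyValuation.polynomial Fq ha

variable (Fq) in
theorem natDegree_carlitzD (i : ℕ) : (carlitzD Fq i).natDegree = i * q ^ i := by
  induction i with
  | zero => simp [carlitzD]
  | succ i ih =>
    have h := carlitzD_ne_zero (Fq := Fq) (i + 1)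
    rw [carlitzD] at h ⊢
    rw [Polynomial.natDegree_mul (left_ne_zero_of_mul h) (right_ne_zero_of_mul h),
      FiniteField.X_pow_card_pow_sub_X_natDegree_eq _ i.succ_ne_zero Fintype.one_lt_card,
      Polynomial.natDegree_pow, ih, Nat.succ_eq_add_one]
    ring

variable {σ : Type*} [Fintype σ]

open Classical in
theorem gaussLE_twistedSum_monics (j : ℕ) :
    GaussLE (RatFunc.inftyValuation Fq) (twistedSum σ (monics Fq j)) (exp (-(j : ℤ))) := by
  refine GaussLE.sum fun a ha => ?_
  rw [mem_monics] at ha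
  have := GaussLE.smul (v := RatFunc.inftyValuation Fq)
    (c := (algebraMap Fq[X] (RatFunc Fq) a)⁻¹) le_rfl (gaussLE_twistedProd (σ := σ) _ a)
  rwa [map_inv₀, inftyValuation_algebraMap ha.1.ne_zero, ha.2, mul_one, ← exp_neg] at this

/-- Every coefficient lies in A by integrality, yet has negative degree. -/
theorem starkCoeff_eq_zero {d : ℕ} (hd : d ≠ 0) (h : Fintype.card σ ≤ d * (q - 1)) :
    starkCoeff Fq σ d = 0 := by
  classical
  have hG : GaussLE (RatFunc.inftyValuation Fq) (starkCoeff Fq σ d) (exp (-1 : ℤ)) := by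
    refine GaussLE.sum fun i hi => ?_
    have h1 := gaussLE_tau_iterate (v := RatFunc.inftyValuation Fq) (σ := σ)
      (β := fun j => exp ((q ^ j : ℕ) : ℤ))
      (fun j => by rw [← exp_zero, exp_le_exp]; positivity)
      (fun j => by rw [inftyValuation_algebraMap (by simp), Polynomial.natDegree_X_pow])
      (gaussLE_twistedSum_monics (d - i)) i
    have h2 := h1.smul (c := (algebraMap Fq[X] (RatFunc Fq) (carlitzD Fq i))⁻¹) le_rfl
    refine h2.mono ?_
    rw [map_inv₀, inftyValuation_algebraMap (carlitzD_ne_zero i), natDegree_carlitzD, ← exp_neg]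
    have h3 : ∏ j ∈ Finset.range i, exp ((q ^ j : ℕ) : ℤ) =
        exp ((∑ j ∈ Finset.range i, q ^ j : ℕ) : ℤ) := by
      clear h1 h2 hi
      induction i with
      | zero => simp
      | succ i ih => rw [Finset.prod_range_succ, ih, Finset.sum_range_succ, ← exp_add, Nat.cast_add]
    rw [h3, ← exp_nsmul, ← exp_nsmul, ← exp_add, ← exp_add, exp_le_exp]
    -- With S = 1 + q + ⋯ + q^(i-1), so that q^i = mS + 1, the degree is at most sS - (d-i)q^i - i
    -- q^i. As sS ≤ dmS = d(q^i - 1), this is at most -d.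
    obtain ⟨m, hm⟩ : ∃ m, q = m + 1 := ⟨q - 1, (Nat.sub_add_cancel Fintype.card_pos).symm⟩
    rw [hm, Nat.add_sub_cancel] at h
    have h5 := geom_sum_mul_add m i
    rw [hm]
    generalize ∑ j ∈ Finset.range i, (m + 1) ^ j = S at *
    generalize (m + 1) ^ i = Q at *
    generalize Fintype.card σ = s at *
    have h6 : s * S ≤ d * m * S := Nat.mul_le_mul_right S h
    obtain ⟨e, rfl⟩ : ∃ e, d = i + e := ⟨d - i, by rw [Finset.mem_range] at hi; omega⟩
    subst h5
    have h7 : 1 ≤ i + e := by omega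
    rw [Nat.add_sub_cancel_left]
    zify at h6 h7
    push_cast
    simp only [nsmul_eq_mul]
    push_cast
    linarith
  ext m
  rw [MvPolynomial.coeff_zero]
  obtain ⟨a, ha⟩ := exists_algebraMap_of_gaussLE (gaussLE_starkCoeff (Fq := Fq) (σ := σ) d) m
  have h2 := hG m
  rw [← ha] at h2 ⊢
  by_contra h0
  have ha0 : a ≠ 0 := by
    rintro rfl
    simp at h0
  rw [inftyValuation_algebraMap ha0, exp_le_exp] at h2
  omega

end Infinity
end AndersonStark

end

noncomputable section

namespace AndersonStark

variable {Fq : Type*} [Field Fq] [Fintype Fq]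

local notation "q" => Fintype.card Fq

/-! ### The Carlitz action on algebras -/

section Carlitz

variable {R : Type*} [CommRing R] [Algebra Fq R] [Algebra Fq[X] R]

theorem carlitz_one_apply (x : R) : carlitz Fq R 1 x = x := by
  rw [map_one, Module.End.one_apply]

theorem carlitz_X_apply (x : R) :
    carlitz Fq R Polynomial.X x = algebraMap Fq[X] R Polynomial.X * x + x ^ q := by
  simp [carlitz]

theorem carlitz_X_pow_succ_apply (n : ℕ) (x : R) :
    carlitz Fq R (Polynomial.X ^ (n + 1)) x =
      algebraMap Fq[X] R Polynomial.X * carlitz Fq R (Polynomial.X ^ n) x +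
        carlitz Fq R (Polynomial.X ^ n) x ^ q := by
  rw [pow_succ', map_mul, Module.End.mul_apply, carlitz_X_apply]

theorem map_carlitz {R' : Type*} [CommRing R'] [Algebra Fq R'] [Algebra Fq[X] R']
    [IsScalarTower Fq Fq[X] R] [IsScalarTower Fq Fq[X] R'] (f : R →+* R')
    (hf : ∀ a, f (algebraMap Fq[X] R a) = algebraMap Fq[X] R' a) (a : Fq[X]) (x : R) :
    f (carlitz Fq R a x) = carlitz Fq R' a (f x) := by
  have hf' (c : Fq) : f (algebraMap Fq R c) = algebraMap Fq R' c := by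
    rw [IsScalarTower.algebraMap_apply Fq Fq[X] R, hf, ← IsScalarTower.algebraMap_apply]
  induction a using Polynomial.induction_on' with
  | add a b ha hb => simp only [map_add, LinearMap.add_apply, ha, hb]
  | monomial n c =>
    rw [← Polynomial.smul_X_eq_monomial, map_smul, map_smul, LinearMap.smul_apply,
      LinearMap.smul_apply, Algebra.smul_def, Algebra.smul_def, map_mul, hf']
    congr 1
    induction n with
    | zero => simp
    | succ n ih =>
      rw [carlitz_X_pow_succ_apply, carlitz_X_pow_succ_apply, map_add, map_mul, hf, map_pow f, ih]

theorem dvd_carlitz_X_pow (n : ℕ) (x : R) : x ∣ carlitz Fq R (Polynomial.X ^ n) x := by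
  induction n with
  | zero => rw [pow_zero, carlitz_one_apply]
  | succ n ih =>
    rw [carlitz_X_pow_succ_apply]
    exact dvd_add (ih.mul_left _) (ih.trans (dvd_pow_self _ Fintype.card_ne_zero))

end Carlitz

/-! ### From operators in t back to polynomials in X -/

section Transform

variable {R : Type*} [CommRing R] [Algebra Fq R] [Algebra Fq[X] R] {σ : Type*} [Fintype σ]

variable (Fq) in
/-- The product `C_{θ ^ m_1}(x_1) ⋯ C_{θ ^ m_s}(x_s)`. -/
def carlitzMonomial (x : σ → R) (m : σ →₀ ℕ) : R :=
  ∏ k, carlitz Fq R (Polynomial.X ^ m k) (x k)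

variable (Fq R σ) in
/-- The linear map from `R[t_1, …, t_s]` to `R[X_1, …, X_s]` that sends the monomial
`t_1 ^ m_1 ⋯ t_s ^ m_s` to `C_{θ ^ m_1}(X_1) ⋯ C_{θ ^ m_s}(X_s)`. -/
def carlitzTransform : MvPolynomial σ R →ₗ[R] MvPolynomial σ R :=
  (MvPolynomial.basisMonomials σ R).constr R (carlitzMonomial Fq MvPolynomial.X)

theorem carlitzTransform_monomial (m : σ →₀ ℕ) (c : R) :
    carlitzTransform Fq R σ (MvPolynomial.monomial m c) =
      c • carlitzMonomial Fq MvPolynomial.X m := by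
  have h : MvPolynomial.monomial m c = c • MvPolynomial.basisMonomials σ R m := by
    simp [MvPolynomial.smul_monomial]
  rw [h, map_smul, carlitzTransform, Module.Basis.constr_basis]

theorem carlitzTransform_apply (F : MvPolynomial σ R) :
    carlitzTransform Fq R σ F =
      ∑ m ∈ F.support, F.coeff m • carlitzMonomial Fq MvPolynomial.X m := by
  conv_lhs => rw [F.as_sum, map_sum]
  exact Finset.sum_congr rfl fun m _ => carlitzTransform_monomial _ _

theorem map_carlitzTransform {R' : Type*} [CommRing R'] [Algebra Fq R'] [Algebra Fq[X] R']
    [IsScalarTower Fq Fq[X] R] [IsScalarTower Fq Fq[X] R'] (f : R →+* R')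
    (hf : ∀ a, f (algebraMap Fq[X] R a) = algebraMap Fq[X] R' a) (F : MvPolynomial σ R) :
    MvPolynomial.map f (carlitzTransform Fq R σ F) =
      carlitzTransform Fq R' σ (MvPolynomial.map f F) := by
  induction F using MvPolynomial.induction_on' with
  | add F G hF hG => simp only [map_add, hF, hG]
  | monomial m c =>
    rw [MvPolynomial.map_monomial, carlitzTransform_monomial, carlitzTransform_monomial,
      MvPolynomial.smul_eq_C_mul, MvPolynomial.smul_eq_C_mul, map_mul, MvPolynomial.map_C,
      carlitzMonomial, carlitzMonomial, map_prod]
    congr 1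
    refine Finset.prod_congr rfl fun k _ => ?_
    rw [map_carlitz, MvPolynomial.map_X]
    intro a
    rw [MvPolynomial.algebraMap_apply, MvPolynomial.algebraMap_apply, MvPolynomial.map_C, hf]

variable (Fq R) in
/-- The linear map that sends `t ^ n` to `C_{θ ^ n}(x)`. -/
def carlitzEval {S : Type*} [CommRing S] [Algebra Fq S] [Algebra Fq[X] S] [Algebra R S] (x : S) :
    R[X] →ₗ[R] S :=
  (Polynomial.basisMonomials R).constr R fun n => carlitz Fq S (Polynomial.X ^ n) x

theorem carlitzEval_monomial {S : Type*} [CommRing S] [Algebra Fq S] [Algebra Fq[X] S]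
    [Algebra R S] (x : S) (n : ℕ) (c : R) :
    carlitzEval Fq R x (Polynomial.monomial n c) = c • carlitz Fq S (Polynomial.X ^ n) x := by
  have h : Polynomial.monomial n c = c • Polynomial.basisMonomials R n := by
    simp [Polynomial.smul_monomial]
  rw [h, map_smul, carlitzEval, Module.Basis.constr_basis]

/-- Both sides are multilinear in the f k, so it suffices to compare them on powers of the variable.
-/
theorem carlitzTransform_prod (f : σ → R[X]) :
    carlitzTransform Fq R σ (∏ k, Polynomial.aeval (MvPolynomial.X k) (f k)) =
      ∏ k, carlitzEval Fq R (MvPolynomial.X k : MvPolynomial σ R) (f k) := by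
  classical
  let L : MultilinearMap R (fun _ : σ => R[X]) (MvPolynomial σ R) :=
    (carlitzTransform Fq R σ).compMultilinearMap
      ((MultilinearMap.mkPiAlgebra R σ (MvPolynomial σ R)).compLinearMap
        fun k => (Polynomial.aeval (MvPolynomial.X k)).toLinearMap)
  let L' : MultilinearMap R (fun _ : σ => R[X]) (MvPolynomial σ R) :=
    (MultilinearMap.mkPiAlgebra R σ (MvPolynomial σ R)).compLinearMap
        fun k => carlitzEval Fq R (MvPolynomial.X k)
  suffices L = L' by
    have := congrArg (fun M => M f) this
    simpa [L, L'] using this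
  refine Module.Basis.ext_multilinear (fun _ => Polynomial.basisMonomials R) fun w => ?_
  have h : (∏ k, (MvPolynomial.X k : MvPolynomial σ R) ^ w k) =
      MvPolynomial.monomial (Finsupp.equivFunOnFinite.symm w) 1 := by
    rw [MvPolynomial.monomial_eq, map_one, one_mul, Finsupp.prod_fintype _ _ (by simp)]
    rfl
  simp [L, L', carlitzEval_monomial, h, carlitzTransform_monomial, carlitzMonomial]

variable [IsScalarTower Fq Fq[X] R]

theorem carlitzEval_map (k : σ) (a : Fq[X]) :
    carlitzEval Fq R (MvPolynomial.X k : MvPolynomial σ R) (a.map (algebraMap Fq R)) =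
      carlitz Fq (MvPolynomial σ R) a (MvPolynomial.X k) := by
  induction a using Polynomial.induction_on' with
  | add a b ha hb => simp only [Polynomial.map_add, map_add, LinearMap.add_apply, ha, hb]
  | monomial n c =>
    rw [Polynomial.map_monomial, carlitzEval_monomial, algebraMap_smul,
      ← Polynomial.smul_X_eq_monomial, map_smul, LinearMap.smul_apply]

/-- C_{θ^(n+1)}(x) - θ C_{θ^n}(x) = C_{θ^n}(x)^q: this is why `tau` multiplies by t_k - θ. -/
theorem carlitzEval_X_sub_C_mul_X_pow (k : σ) (n : ℕ) :
    carlitzEval Fq R (MvPolynomial.X k : MvPolynomial σ R)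
      ((Polynomial.X - Polynomial.C (algebraMap Fq[X] R Polynomial.X)) * Polynomial.X ^ n) =
      carlitz Fq (MvPolynomial σ R) (Polynomial.X ^ n) (MvPolynomial.X k) ^ q := by
  have h : (Polynomial.X - Polynomial.C (algebraMap Fq[X] R Polynomial.X)) * Polynomial.X ^ n =
      Polynomial.monomial (n + 1) 1 - Polynomial.monomial n (algebraMap Fq[X] R Polynomial.X) := by
    rw [← Polynomial.C_mul_X_pow_eq_monomial, ← Polynomial.C_mul_X_pow_eq_monomial, map_one]
    ring
  rw [h, map_sub, carlitzEval_monomial, carlitzEval_monomial, one_smul, carlitz_X_pow_succ_apply,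
    MvPolynomial.smul_eq_C_mul, MvPolynomial.algebraMap_apply, add_sub_cancel_left]

theorem carlitzTransform_twistedProd (a : Fq[X]) :
    carlitzTransform Fq (RatFunc Fq) σ (twistedProd σ a) =
      ∏ k, carlitz Fq (MvPolynomial σ (RatFunc Fq)) a (MvPolynomial.X k) := by
  have h := carlitzTransform_prod (Fq := Fq) (σ := σ) fun _ => a.map (algebraMap Fq (RatFunc Fq))
  simpa only [twistedProd, Polynomial.aeval_map_algebraMap, carlitzEval_map] using h

theorem carlitzTransform_tau (F : MvPolynomial σ (RatFunc Fq)) :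
    carlitzTransform Fq (RatFunc Fq) σ (tau Fq σ F) = carlitzTransform Fq (RatFunc Fq) σ F ^ q := by
  induction F using MvPolynomial.induction_on' with
  | add F G hF hG => simp only [map_add, hF, hG, add_pow_card]
  | monomial m c =>
    have h1 : tau Fq σ (MvPolynomial.monomial m 1) = ∏ k, Polynomial.aeval (MvPolynomial.X k)
        ((Polynomial.X - Polynomial.C (algebraMap Fq[X] (RatFunc Fq) Polynomial.X)) *
          Polynomial.X ^ m k) := by
      rw [tau_apply, MvPolynomial.map_monomial, map_one, MvPolynomial.monomial_eq, map_one, one_mul,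
        Finsupp.prod_fintype _ _ (by simp), ← Finset.prod_mul_distrib]
      refine Finset.prod_congr rfl fun k _ => ?_
      simp [carlitzBasis, MvPolynomial.algebraMap_apply, MvPolynomial.algebraMap_eq]
    have h2 : MvPolynomial.monomial m c = c • MvPolynomial.monomial m (1 : RatFunc Fq) := by
      simp [MvPolynomial.smul_monomial]
    rw [h2, tau_smul, map_smul, map_smul, smul_pow, h1, carlitzTransform_prod,
      carlitzTransform_monomial, one_smul, carlitzMonomial, ← Finset.prod_pow]
    simp only [carlitzEval_X_sub_C_mul_X_pow]

theorem carlitzTransform_tau_iterate (i : ℕ) (F : MvPolynomial σ (RatFunc Fq)) :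
    carlitzTransform Fq (RatFunc Fq) σ ((tau Fq σ)^[i] F) =
      carlitzTransform Fq (RatFunc Fq) σ F ^ q ^ i := by
  induction i with
  | zero => simp
  | succ i ih => rw [Function.iterate_succ_apply', carlitzTransform_tau, ih, ← pow_mul, pow_succ]

end Transform

/-! ### Coefficients of the special series -/

section Series

variable {σ : Type*}

/-- In characteristic p the power q^i is an iterated Frobenius: it raises coefficients to that power
and expands the variable. -/
theorem coeff_pow_card_pow {R : Type*} [CommRing R] [Algebra Fq R] [Nontrivial R]
    (G : PowerSeries R) (i n : ℕ) :
    PowerSeries.coeff n (G ^ q ^ i) =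
      if q ^ i ∣ n then PowerSeries.coeff (n / q ^ i) G ^ q ^ i else 0 := by
  obtain ⟨p, hp⟩ := CharP.exists Fq
  obtain ⟨e, hp1, he⟩ := FiniteField.card Fq p
  have : Fact p.Prime := ⟨hp1⟩
  have : CharP R p := charP_of_injective_algebraMap (algebraMap Fq R).injective p
  have : ExpChar R p := ExpChar.prime hp1
  have h := MvPowerSeries.map_iterateFrobenius_expand p hp1.ne_zero G (e * i)
  rw [he, ← pow_mul, ← h]
  have h2 := PowerSeries.coeff_expand (p ^ ((e : ℕ) * i)) (pow_ne_zero _ hp1.ne_zero) G (n := n)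
  refine (PowerSeries.coeff_map (iterateFrobenius R p (e * i)) n
    (PowerSeries.expand (p ^ ((e : ℕ) * i)) (pow_ne_zero _ hp1.ne_zero) G)).trans ?_
  rw [h2]
  split_ifs
  · rw [iterateFrobenius_def]
  · rw [map_zero]

theorem coeff_starSeries (a : Fq[X]) (F : MvPolynomial σ (RatFunc Fq)) (n : ℕ) :
    PowerSeries.coeff n (starSeries a (PowerSeries.C F * PowerSeries.X)) =
      if n = q ^ a.natDegree then starPoly a F else 0 := by
  have hq : 0 < q ^ a.natDegree := pow_pos Fintype.card_pos _
  rw [starSeries, PowerSeries.coeff_expand, PowerSeries.coeff_mk, PowerSeries.coeff_C_mul,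
    PowerSeries.coeff_X]
  by_cases h : q ^ a.natDegree ∣ n
  · obtain ⟨m, rfl⟩ := h
    rw [if_pos (dvd_mul_right _ _), Nat.mul_div_cancel_left _ hq]
    by_cases hm : m = 1
    · simp [hm]
    · rw [if_neg hm, if_neg (by simpa [hq.ne'] using hm), mul_zero, starPoly, map_zero]
  · rw [if_neg h, if_neg]
    rintro rfl
    exact h dvd_rfl

theorem coeff_lSeries_card_pow (F : MvPolynomial σ (RatFunc Fq)) (j : ℕ) :
    PowerSeries.coeff (q ^ j) (lSeries F) =
      ∑ a ∈ monics Fq j, (algebraMap Fq[X] (RatFunc Fq) a)⁻¹ • starPoly a F := by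
  rw [lSeries, PowerSeries.coeff_mk]
  simp only [coeff_starSeries]
  have hinj : ∀ a : Fq[X], q ^ j = q ^ a.natDegree ↔ a.natDegree = j := fun a =>
    (Nat.pow_right_injective Fintype.one_lt_card).eq_iff.trans eq_comm
  simp only [hinj]
  refine (finsum_mem_eq_sum_of_inter_support_eq (s := {a : Fq[X] | a.Monic}) (t := monics Fq j)
    _ ?_).trans (Finset.sum_congr rfl fun a ha => by rw [if_pos (mem_monics.mp ha).2])
  ext a
  by_cases h : a.natDegree = j <;> simp [h]

theorem coeff_lSeries_of_ne (F : MvPolynomial σ (RatFunc Fq)) {n : ℕ} (h : ∀ j, n ≠ q ^ j) :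
    PowerSeries.coeff n (lSeries F) = 0 := by
  rw [lSeries, PowerSeries.coeff_mk]
  simp [coeff_starSeries, h]

theorem coeff_logAlgSeries_of_ne (F : MvPolynomial σ (RatFunc Fq)) {n : ℕ} (h : ∀ j, n ≠ q ^ j) :
    PowerSeries.coeff n (logAlgSeries F) = 0 := by
  rw [logAlgSeries, carlitzExp, PowerSeries.coeff_mk]
  refine finsum_eq_zero_of_forall_eq_zero fun i => ?_
  rw [coeff_pow_card_pow]
  split_ifs with hd
  · obtain ⟨m, rfl⟩ := hd
    rw [Nat.mul_div_cancel_left _ (pow_pos Fintype.card_pos _), coeff_lSeries_of_ne, zero_pow,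
      smul_zero]
    · exact pow_ne_zero _ Fintype.card_ne_zero
    · rintro j rfl
      exact h (i + j) (pow_add _ _ _).symm
  · rw [smul_zero]

theorem coeff_logAlgSeries_card_pow (F : MvPolynomial σ (RatFunc Fq)) (d : ℕ) :
    PowerSeries.coeff (q ^ d) (logAlgSeries F) =
      ∑ i ∈ Finset.range (d + 1), (algebraMap Fq[X] (RatFunc Fq) (carlitzD Fq i))⁻¹ •
        PowerSeries.coeff (q ^ (d - i)) (lSeries F) ^ q ^ i := by
  rw [logAlgSeries, carlitzExp, PowerSeries.coeff_mk,
    finsum_eq_sum_of_support_subset (s := Finset.range (d + 1))]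
  · refine Finset.sum_congr rfl fun i hi => ?_
    rw [Finset.mem_range] at hi
    rw [coeff_pow_card_pow, if_pos (pow_dvd_pow _ (by omega)),
      Nat.pow_div (by omega) Fintype.card_pos]
  · intro i hi
    rw [Function.mem_support, coeff_pow_card_pow] at hi
    rw [Finset.mem_coe, Finset.mem_range]
    by_contra h
    rw [if_neg, smul_zero] at hi
    · exact hi rfl
    · rw [Nat.pow_dvd_pow_iff_le_right Fintype.one_lt_card]
      omega

theorem coeff_specialSeries_card_pow (s d : ℕ) :
    PowerSeries.coeff (q ^ d) (specialSeries Fq s) =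
      carlitzTransform Fq (RatFunc Fq) (Fin s) (starkCoeff Fq (Fin s) d) := by
  rw [specialSeries, coeff_logAlgSeries_card_pow, starkCoeff, expSeq, map_sum]
  refine Finset.sum_congr rfl fun i _ => ?_
  rw [map_smul, carlitzTransform_tau_iterate, coeff_lSeries_card_pow, twistedSum, map_sum]
  simp only [map_smul, carlitzTransform_twistedProd, starPoly, map_prod, MvPolynomial.aeval_X]

end Series
end AndersonStark

end

noncomputable section

namespace AndersonStark

variable {Fq : Type*} [Field Fq] [Fintype Fq]

local notation "q" => Fintype.card Fq

/-! ### The special polynomial over A -/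

section IntegralForm

variable {σ : Type*} [Fintype σ]

variable (Fq σ) in
theorem exists_map_eq_starkCoeff (d : ℕ) : ∃ G : MvPolynomial σ Fq[X],
    MvPolynomial.map (algebraMap Fq[X] (RatFunc Fq)) G = starkCoeff Fq σ d := by
  choose a ha using exists_algebraMap_of_gaussLE (gaussLE_starkCoeff (Fq := Fq) (σ := σ) d)
  refine ⟨∑ m ∈ (starkCoeff Fq σ d).support, MvPolynomial.monomial m (a m), ?_⟩
  conv_rhs => rw [(starkCoeff Fq σ d).as_sum]
  rw [map_sum]
  exact Finset.sum_congr rfl fun m _ => by rw [MvPolynomial.map_monomial, ha]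

variable (Fq σ) in
/-- The polynomial `starkCoeff Fq σ d`, with coefficients in `A`. -/
def integralStarkCoeff (d : ℕ) : MvPolynomial σ Fq[X] := (exists_map_eq_starkCoeff Fq σ d).choose

theorem map_integralStarkCoeff (d : ℕ) :
    MvPolynomial.map (algebraMap Fq[X] (RatFunc Fq)) (integralStarkCoeff Fq σ d) =
      starkCoeff Fq σ d := (exists_map_eq_starkCoeff Fq σ d).choose_spec

theorem integralStarkCoeff_eq_zero {d : ℕ} (hd : d ≠ 0) (h : Fintype.card σ ≤ d * (q - 1)) :
    integralStarkCoeff Fq σ d = 0 := by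
  refine MvPolynomial.map_injective _ (IsFractionRing.injective Fq[X] (RatFunc Fq)) ?_
  rw [map_integralStarkCoeff, starkCoeff_eq_zero hd h, map_zero]

theorem integralStarkCoeff_zero : integralStarkCoeff Fq σ 0 = 1 := by
  refine MvPolynomial.map_injective _ (IsFractionRing.injective Fq[X] (RatFunc Fq)) ?_
  have h : monics Fq 0 = {1} := by
    ext a
    rw [mem_monics, Finset.mem_singleton]
    refine ⟨fun h => h.1.natDegree_eq_zero.mp h.2, ?_⟩
    rintro rfl
    simp
  rw [map_integralStarkCoeff, map_one, starkCoeff]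
  simp [expSeq, carlitzD, twistedSum, h, twistedProd]

variable (Fq σ) in
/-- The term of degree `q ^ d` in `Z` of the special polynomial. -/
def specialTerm (d : ℕ) : MvPolynomial (Option σ) Fq[X] :=
  MvPolynomial.rename some (carlitzTransform Fq Fq[X] σ (integralStarkCoeff Fq σ d)) *
    MvPolynomial.X none ^ q ^ d

variable (Fq σ) in
/-- The special polynomial `𝕊_s`, in `A[X_1, …, X_s, Z]`. -/
def specialPolynomial : MvPolynomial (Option σ) Fq[X] :=
  ∑ d ∈ Finset.range (Fintype.card σ + 1), specialTerm Fq σ d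

theorem specialTerm_eq_zero {d : ℕ} (hd : d ≠ 0) (h : Fintype.card σ ≤ d * (q - 1)) :
    specialTerm Fq σ d = 0 := by
  rw [specialTerm, integralStarkCoeff_eq_zero hd h, map_zero, map_zero, zero_mul]

theorem specialTerm_zero :
    specialTerm Fq σ 0 = (∏ k, MvPolynomial.X (some k)) * MvPolynomial.X none := by
  have h : (1 : MvPolynomial σ Fq[X]) = MvPolynomial.monomial 0 1 := rfl
  rw [specialTerm, integralStarkCoeff_zero, h, carlitzTransform_monomial, one_smul, pow_zero,
    pow_one, carlitzMonomial, map_prod]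
  simp

theorem toSeries_rename (F : MvPolynomial σ Fq[X]) :
    toSeries Fq σ (MvPolynomial.rename some F) =
      PowerSeries.C (MvPolynomial.map (algebraMap Fq[X] (RatFunc Fq)) F) := by
  have h : ((toSeries Fq σ).comp (MvPolynomial.rename some : _ →ₐ[Fq[X]] _).toRingHom) =
      (PowerSeries.C).comp (MvPolynomial.map (algebraMap Fq[X] (RatFunc Fq))) := by
    refine MvPolynomial.ringHom_ext (fun a => ?_) fun k => ?_
    · simp [toSeries, MvPolynomial.optionEquivLeft_C]
    · simp [toSeries, MvPolynomial.optionEquivLeft_X_some]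
  exact RingHom.congr_fun h F

theorem toSeries_X_none : toSeries Fq σ (MvPolynomial.X none) = PowerSeries.X := by
  simp [toSeries, MvPolynomial.optionEquivLeft_X_none]

theorem toSeries_specialTerm (d : ℕ) :
    toSeries Fq σ (specialTerm Fq σ d) =
      PowerSeries.C (carlitzTransform Fq (RatFunc Fq) σ (starkCoeff Fq σ d)) *
        PowerSeries.X ^ q ^ d := by
  rw [specialTerm, map_mul, map_pow, toSeries_X_none, toSeries_rename,
    map_carlitzTransform _ (fun a => rfl), map_integralStarkCoeff]

theorem toSeries_specialPolynomial (s : ℕ) :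
    toSeries Fq (Fin s) (specialPolynomial Fq (Fin s)) = specialSeries Fq s := by
  ext1 n
  rw [specialPolynomial, map_sum, map_sum]
  simp only [toSeries_specialTerm, PowerSeries.coeff_C_mul, PowerSeries.coeff_X_pow]
  by_cases hn : ∃ d, n = q ^ d
  · obtain ⟨d, rfl⟩ := hn
    have hinj : ∀ e, q ^ d = q ^ e ↔ d = e := fun e =>
      (Nat.pow_right_injective Fintype.one_lt_card).eq_iff
    simp only [hinj, mul_ite, mul_one, mul_zero]
    rw [Finset.sum_ite_eq, coeff_specialSeries_card_pow]
    split_ifs with h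
    · rfl
    -- Beyond the cutoff d > s, and q - 1 ≥ 1 gives s ≤ d(q - 1), so the discarded coefficients
    -- vanish.
    · rw [Finset.mem_range, Fintype.card_fin] at h
      have hq : 1 ≤ q - 1 := Nat.sub_pos_of_lt Fintype.one_lt_card
      rw [starkCoeff_eq_zero (by omega), map_zero]
      rw [Fintype.card_fin]
      nlinarith
  · push Not at hn
    rw [specialSeries, coeff_logAlgSeries_of_ne _ hn]
    simp [hn]

theorem degreeOf_specialPolynomial_le {N : ℕ} (h : Fintype.card σ ≤ (N + 1) * (q - 1)) :
    (specialPolynomial Fq σ).degreeOf none ≤ q ^ N := by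
  classical
  refine (MvPolynomial.degreeOf_sum_le _ _ _).trans (Finset.sup_le fun d _ => ?_)
  by_cases hd : d ≤ N
  · refine (MvPolynomial.degreeOf_mul_le _ _ _).trans ?_
    have h0 : (MvPolynomial.rename some
        (carlitzTransform Fq Fq[X] σ (integralStarkCoeff Fq σ d))).degreeOf none = 0 := by
      rw [MvPolynomial.degreeOf_def, Multiset.count_eq_zero]
      intro hm
      rw [← Multiset.mem_toFinset, ← MvPolynomial.vars_def] at hm
      obtain ⟨k, _, hk⟩ := MvPolynomial.mem_vars_rename _ _ hm
      exact Option.some_ne_none k hk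
    rw [h0, zero_add]
    refine (MvPolynomial.degreeOf_pow_le _ _ _).trans ?_
    rw [MvPolynomial.degreeOf_X_self, mul_one]
    exact Nat.pow_le_pow_right Fintype.card_pos hd
  · rw [specialTerm_eq_zero (by omega), MvPolynomial.degreeOf_zero]
    · exact Nat.zero_le _
    · exact h.trans (Nat.mul_le_mul_right _ (by omega))

theorem specialPolynomial_eq (h : Fintype.card σ ≤ q - 1) :
    specialPolynomial Fq σ = (∏ k, MvPolynomial.X (some k)) * MvPolynomial.X none := by
  rw [specialPolynomial, Finset.sum_eq_single 0, specialTerm_zero]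
  · intro d _ hd
    exact specialTerm_eq_zero hd (h.trans (Nat.le_mul_of_pos_left _ (Nat.pos_of_ne_zero hd)))
  · simp

/-- Each C_{θ^m}(X_k) is divisible by X_k, and each exponent q^d of Z is positive. -/
theorem dvd_specialPolynomial :
    (∏ k : σ, MvPolynomial.X (some k)) * MvPolynomial.X none ∣ specialPolynomial Fq σ := by
  refine Finset.dvd_sum fun d _ => mul_dvd_mul ?_
    (dvd_pow_self _ (pow_ne_zero _ Fintype.card_ne_zero))
  have h : (∏ k : σ, MvPolynomial.X (some k) : MvPolynomial (Option σ) Fq[X]) =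
      MvPolynomial.rename some (∏ k : σ, MvPolynomial.X k) := by simp
  rw [h]
  refine map_dvd _ ?_
  rw [carlitzTransform_apply]
  refine Finset.dvd_sum fun m _ => ?_
  rw [MvPolynomial.smul_eq_C_mul]
  exact (Finset.prod_dvd_prod_of_dvd _ _ fun k _ => dvd_carlitz_X_pow (m k) _).mul_left _

end IntegralForm

/-! ### Linearity in each variable -/

section Linearity

theorem IsFqLinearIn.sum_smul {ι R κ : Type*} [DecidableEq ι] [CommRing R] [Algebra Fq R]
    {s : Finset κ} {P : κ → MvPolynomial ι R} (c : κ → R) {j : ι}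
    (h : ∀ i ∈ s, IsFqLinearIn Fq (P i) j) : IsFqLinearIn Fq (∑ i ∈ s, c i • P i) j := by
  constructor
  · simp only [map_sum, map_smul]
    rw [← Finset.sum_add_distrib]
    exact Finset.sum_congr rfl fun i hi => by rw [(h i hi).1, smul_add]
  · intro a
    simp only [map_sum, map_smul]
    rw [Finset.smul_sum]
    exact Finset.sum_congr rfl fun i hi => by rw [(h i hi).2 a, smul_comm]

variable {σ : Type*} [Fintype σ]

variable (Fq) in
/-- The multilinear map `(x, z) ↦ C_{θ ^ m_1}(x_1) ⋯ C_{θ ^ m_s}(x_s) z ^ (q ^ d)`. -/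
def carlitzMultilinear (R : Type*) [CommRing R] [Algebra Fq R] [Algebra Fq[X] R] (m : σ →₀ ℕ)
    (d : ℕ) : MultilinearMap Fq (fun _ : Option σ => R) R :=
  (MultilinearMap.mkPiAlgebra Fq (Option σ) R).compLinearMap fun o =>
    o.elim (frobeniusPow Fq R d).toLinearMap fun k => carlitz Fq R (Polynomial.X ^ m k)

theorem carlitzMultilinear_apply (R : Type*) [CommRing R] [Algebra Fq R] [Algebra Fq[X] R]
    (m : σ →₀ ℕ) (d : ℕ) (x : Option σ → R) :
    carlitzMultilinear Fq R m d x = carlitzMonomial Fq (fun k => x (some k)) m * x none ^ q ^ d := by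
  simp [carlitzMultilinear, Fintype.prod_option, carlitzMonomial, frobeniusPow_apply, mul_comm]

/-- Substitution into a basic product is evaluation of a multilinear map, because the Carlitz action
is natural in the algebra. Both linearity conditions are then instances of multilinearity. -/
theorem aeval_rename_carlitzMonomial {R : Type*} [CommRing R] [Algebra Fq R] [Algebra Fq[X] R]
    [IsScalarTower Fq Fq[X] R] (m : σ →₀ ℕ) (d : ℕ) (x : Option σ → R) :
    MvPolynomial.aeval x (MvPolynomial.rename some
      (carlitzMonomial Fq (MvPolynomial.X : σ → MvPolynomial σ Fq[X]) m) *
        MvPolynomial.X none ^ q ^ d) = carlitzMultilinear Fq R m d x := by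
  rw [carlitzMultilinear_apply, map_mul, map_pow, MvPolynomial.aeval_X, MvPolynomial.aeval_rename,
    carlitzMonomial, carlitzMonomial, map_prod]
  congr 1
  refine Finset.prod_congr rfl fun k _ => ?_
  have h := map_carlitz (MvPolynomial.aeval (x ∘ some) : MvPolynomial σ Fq[X] →ₐ[Fq[X]] R).toRingHom
    (fun a => AlgHom.commutes _ a) (Polynomial.X ^ m k) (MvPolynomial.X k)
  simpa using h

theorem isFqLinearIn_carlitzMonomial [DecidableEq (Option σ)] (m : σ →₀ ℕ) (d : ℕ)
    (j : Option σ) : IsFqLinearIn Fq (MvPolynomial.rename some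
      (carlitzMonomial Fq (MvPolynomial.X : σ → MvPolynomial σ Fq[X]) m) *
        MvPolynomial.X none ^ q ^ d) j := by
  constructor
  · rw [aeval_rename_carlitzMonomial, aeval_rename_carlitzMonomial, aeval_rename_carlitzMonomial,
      MultilinearMap.map_update_add]
    rw [Function.update_eq_self_iff.mpr rfl]
  · intro c
    rw [aeval_rename_carlitzMonomial, MultilinearMap.map_update_smul,
      Function.update_eq_self_iff.mpr rfl, ← aeval_rename_carlitzMonomial,
      MvPolynomial.aeval_X_left_apply]

theorem isFqLinearIn_specialPolynomial [DecidableEq (Option σ)] (j : Option σ) :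
    IsFqLinearIn Fq (specialPolynomial Fq σ) j := by
  have h (d : ℕ) : IsFqLinearIn Fq (specialTerm Fq σ d) j := by
    rw [specialTerm, carlitzTransform_apply, map_sum, Finset.sum_mul]
    simp only [map_smul, smul_mul_assoc]
    exact IsFqLinearIn.sum_smul _ fun m _ => isFqLinearIn_carlitzMonomial m d j
  simpa [specialPolynomial] using
    IsFqLinearIn.sum_smul (s := Finset.range (Fintype.card σ + 1)) 1 fun d _ => h d

end Linearity
end AndersonStark

end

/-! ### The main theorem -/

theorem mainTheorem9 (Fq : Type*) [Field Fq] [Fintype Fq] (s : ℕ) (hs : 1 ≤ s) :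
    ∃ S : MvPolynomial (Option (Fin s)) (Polynomial Fq),
      AndersonStark.toSeries Fq (Fin s) S = AndersonStark.specialSeries Fq s ∧
      (∀ j : Option (Fin s), AndersonStark.IsFqLinearIn Fq S j) ∧
      (∏ j : Fin s, MvPolynomial.X (some j)) * MvPolynomial.X none ∣ S ∧
      (∀ r : ℕ, 1 ≤ r → r ≤ Fintype.card Fq - 1 → s ≡ r [MOD Fintype.card Fq - 1] →
        S.degreeOf none ≤ Fintype.card Fq ^ ((s - r) / (Fintype.card Fq - 1))) ∧
      (s ≤ Fintype.card Fq - 1 →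
        S = (∏ j : Fin s, MvPolynomial.X (some j)) * MvPolynomial.X none) := by
  refine ⟨AndersonStark.specialPolynomial Fq (Fin s), AndersonStark.toSeries_specialPolynomial s,
    AndersonStark.isFqLinearIn_specialPolynomial, AndersonStark.dvd_specialPolynomial,
    fun r _ hr hsr => AndersonStark.degreeOf_specialPolynomial_le ?_,
    fun h => AndersonStark.specialPolynomial_eq (by rwa [Fintype.card_fin])⟩
  -- For N = (s - r)/(q - 1), the goal is s ≤ N(q - 1) + (q - 1). If s ≤ r, already s ≤ q - 1;
  -- otherwise the division is exact and r ≤ q - 1.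
  rw [Fintype.card_fin, Nat.add_mul, one_mul]
  rcases le_total s r with h | h
  · omega
  · rw [Nat.div_mul_cancel ((Nat.modEq_iff_dvd' h).mp hsr.symm)]
    omega
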